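/- **Setting.** An *abstract polyhedral complex with a recession fan* is given by disjoint finite sets $V_f\neq\emptyset$ and $V_\infty$, a finite poset $\Pi$ with minimum $\hat 0$, and a map $\zeta:\Pi\to 2^{V_f\cup V_\infty}$ such that $\zeta(\hat 0)=\emptyset$; for every $x\in V_f\cup V_\infty$ exactly one $\tau\in\Pi$ has $\zeta(\tau)=\{x\}$; and for every $\tau\in\Pi$ the map $\zeta$ restricts to an isomorphism from the interval $[\hat 0,\tau]$ onto the poset of subsets of $\zeta(\tau)$. Put $\Delta=\{\tau\in\Pi:\zeta(\tau)\cap V_f\neq\emptyset\}$ and $\Upsilon=\Pi\setminus\Delta$ (the recession fan). For $\tau\in\Delta$ let $$\Theta_\tau=\Bigl\{u\in\mathbb R_{\ge 0}^{V_f\cup V_\infty}: u_x=0 \text{ for } x\notin\zeta(\tau),\ \sum_{v\in V_f}u_v=1\Bigr\},$$ and let $|\Delta|$ be obtained by gluing the $\Theta_\tau$, $\tau\in\Delta$, along the face inclusions $\Theta_\tau\subseteq\Theta_\eta$ for $\tau\preceq\eta$. Similarly $|\Upsilon|$ is obtained by gluing the cones $\mathbb R_{\ge0}^{\zeta(\rho)}$,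 $\rho\in\Upsilon$. For $\tau\in\Delta$ let $\tau_\infty\in[\hat 0,\tau]$ be the element of $\Upsilon$ with $\zeta(\tau_\infty)=\zeta(\tau)\cap V_\infty$. A half-line in $|\Delta|$ is $t\mapsto u+tw$ $(t\ge0)$ in some $\Theta_\tau$, with $u\in\Theta_\tau$ and $0\ne w\in\mathbb R_{\ge 0}^{\zeta(\tau_\infty)}$; it corresponds to the half-line $t\mapsto tw$ of $|\Upsilon|$ in the cone of $\tau_\infty$. Two half-lines of $|\Delta|$ are parallel if they correspond to the same (parametrized) half-line of $|\Upsilon|$. An integral $\mathbb Q$-affine function on $\mathbb R^n$ is one of the form $u\mapsto\langle m,u\rangle+\gamma$ with $m\in\mathbb Z^n$, $\gamma\in\mathbb Q$; an integral $\mathbb Q$-affine polyhedron is defined by finitely many inequalities $L_i\ge 0$ with $L_i$ integral $\mathbb Q$-affine. A function $F:|\Delta|\to\mathbb R$ is piecewise integral $\mathbb Q$-affine if there are finite polyhedral complexes $R_\tau$ of integral $\mathbb Q$-affine polyhedra with support $\Theta_\tau$ $(\tau\in\Delta)$, compatible in the sense that $R_\tau=\{\sigma\in R_\eta:\sigma\subseteq\Theta_\tau\}$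 whenever $\tau\preceq\eta$, such that $F$ restricted to each $\sigma\in R_\tau$ is the restriction of an integral $\mathbb Q$-affine function. Let $\operatorname{Rat}(|\Delta|)$ be the set consisting of $\infty$ and of all piecewise integral $\mathbb Q$-affine functions $F:|\Delta|\to\mathbb R$ which have the same slope near infinity along any two parallel half-lines (that is, for some $s$, $F$ is of the form $c+st$ for large $t$ along both of them, where $c$ may depend on the half-line), with pointwise minimum as addition and pointwise $+$ as multiplication. Let $\mathbb T\mathbb Q=(\mathbb Q\cup\{\infty\},\min,+)$. **Theorem.** For every abstract polyhedral complex $\Delta$ with a recession fan, $\operatorname{Rat}(|\Delta|)$ is a semifield over $\mathbb T\mathbb Q$ and it is finitely generated over $\mathbb T\mathbb Q$: there are finitely many $s_1,\dots,s_r\in\operatorname{Rat}(|\Delta|)$ such that $\operatorname{Rat}(|\Delta|)$ is exactly the set of all fractions $p(s_1,\dots,s_r)/q(s_1,\dots,s_r)$ with $p,q$ polynomials in $r$ variables over $\mathbb T\mathbb Q$ and $q(s_1,\dots,s_r)\ne\infty$. -/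

import Mathlib

namespace TropicalFF

/-! ### Integral `ℚ`-affine polyhedral geometry in `ℝ^ι` -/

section Polyhedra

variable {ι : Type*} [Fintype ι]

/-- Integral `ℚ`-affine functions on `ℝ^ι`: `u ↦ ⟨m, u⟩ + γ` with `m ∈ ℤ^ι` and `γ ∈ ℚ`. -/
def IsIntQAffine (L : (ι → ℝ) → ℝ) : Prop :=
  ∃ (m : ι → ℤ) (γ : ℚ), ∀ u : ι → ℝ, L u = (∑ i, (m i : ℝ) * u i) + (γ : ℝ)

/-- Integral `ℚ`-affine polyhedra: solution sets of finitely many inequalities `L i ≥ 0`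
with `L i` integral `ℚ`-affine. -/
def IsIntQPolyhedron (σ : Set (ι → ℝ)) : Prop :=
  ∃ (r : ℕ) (L : Fin r → (ι → ℝ) → ℝ),
    (∀ i, IsIntQAffine (L i)) ∧ σ = {u | ∀ i, 0 ≤ L i u}

/-- `φ` is a (nonempty) face of the polyhedron `σ`: the locus in `σ` where some linear functional
`⟨a, ·⟩` attains its maximum on `σ` (with `a = 0` one gets `σ` itself). -/
def IsFace (φ σ : Set (ι → ℝ)) : Prop :=
  φ.Nonempty ∧ ∃ a : ι → ℝ, φ = {u ∈ σ | ∀ w ∈ σ, ∑ i, a i * w i ≤ ∑ i, a i * u i}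

/-- A collection `S` of subsets of `ℝ^ι` is an integral `ℚ`-affine polyhedral complex: a finite
collection of nonempty integral `ℚ`-affine polyhedra, closed under taking faces, any two of which
are disjoint or meet along a common face. -/
structure IsIntQComplex (S : Set (Set (ι → ℝ))) : Prop where
  finite : S.Finite
  nonempty : ∀ σ ∈ S, σ.Nonempty
  polyhedron : ∀ σ ∈ S, IsIntQPolyhedron σ
  face_mem : ∀ σ ∈ S, ∀ φ, IsFace φ σ → φ ∈ S
  inter_face : ∀ σ ∈ S, ∀ η ∈ S, (σ ∩ η).Nonempty → IsFace (σ ∩ η) σ ∧ IsFace (σ ∩ η) η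

/-- `S'` refines `S`: they have the same support, and each cell of `S'` lies in a cell of `S`. -/
def Refines (S' S : Set (Set (ι → ℝ))) : Prop :=
  ⋃₀ S' = ⋃₀ S ∧ ∀ σ' ∈ S', ∃ σ ∈ S, σ' ⊆ σ

/-- An integral `ℚ`-affine refinement of a single polyhedron `σ`, regarded as the polyhedral
complex formed by all of its faces. -/
def IsIntQRefinementOf (S : Set (Set (ι → ℝ))) (σ : Set (ι → ℝ)) : Prop :=
  IsIntQComplex S ∧ Refines S {φ | IsFace φ σ}

end Polyhedra

/-! ### Abstract polyhedral complexes with a recession fan -/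

/-- The data of an abstract polyhedral complex with a recession fan, with vertices `Vf` and
recession rays `Vinf`: a delta-complex `P` on the disjoint union `Vf ⊕ Vinf`. That is, a poset `P`
with least element `⊥` and a map `ζ` to subsets of `Vf ⊕ Vinf` such that `ζ ⊥ = ∅`, each singleton
is the image of exactly one element, and for each `τ` the map `ζ` is a bijection from the interval
`[⊥, τ]` onto the set of subsets of `ζ τ` (it is then an isomorphism of posets, see `le_iff`
below). Finiteness is imposed where the structure is used. -/
structure AbstractComplex (Vf Vinf P : Type*) [PartialOrder P] [OrderBot P] where
  ζ : P → Set (Vf ⊕ Vinf)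
  zeta_bot : ζ ⊥ = ∅
  existsUnique_singleton : ∀ x : Vf ⊕ Vinf, ∃! τ : P, ζ τ = {x}
  bijOn_Icc : ∀ τ : P, Set.BijOn ζ (Set.Icc ⊥ τ) (𝒫 (ζ τ))

namespace AbstractComplex

variable {Vf Vinf P : Type*} [PartialOrder P] [OrderBot P] (K : AbstractComplex Vf Vinf P)

/-- On each interval `[⊥, τ]` the map `ζ` is an isomorphism of posets onto the subsets of `ζ τ`. -/
theorem le_iff {τ σ σ' : P} (h : σ ≤ τ) (h' : σ' ≤ τ) : σ ≤ σ' ↔ K.ζ σ ⊆ K.ζ σ' := by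
  constructor
  · intro hs
    exact (K.bijOn_Icc σ').mapsTo ⟨bot_le, hs⟩
  · intro hs
    obtain ⟨ρ, hρ, hρσ⟩ := (K.bijOn_Icc σ').surjOn hs
    have : ρ = σ := (K.bijOn_Icc τ).injOn ⟨bot_le, hρ.2.trans h'⟩ ⟨bot_le, h⟩ hρσ
    exact this ▸ hρ.2

/-- The elements of `Δ`: those `τ` for which `ζ τ` contains a vertex. -/
def cells : Set P := {τ | ∃ v : Vf, Sum.inl v ∈ K.ζ τ}

/-- The elements of the recession fan `Υ`, the complement of `Δ`. -/
def fan : Set P := K.cellsᶜ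

/-- For every `τ` there is an element of `[⊥, τ]` which carries exactly the recession rays
of `τ`. -/
theorem exists_infPart (τ : P) :
    ∃ ρ : P, ρ ≤ τ ∧ K.ζ ρ = K.ζ τ ∩ Set.range Sum.inr := by
  obtain ⟨ρ, hρ, h⟩ := (K.bijOn_Icc τ).surjOn
    (show K.ζ τ ∩ Set.range Sum.inr ∈ 𝒫 (K.ζ τ) from Set.inter_subset_left)
  exact ⟨ρ, hρ.2, h⟩

/-- The infinite part `τ_∞` of `τ`: the (unique) element of `[⊥, τ]` with
`ζ τ_∞ = ζ τ ∩ V_∞`. -/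
noncomputable def infPart (τ : P) : P := (K.exists_infPart τ).choose

theorem infPart_le (τ : P) : K.infPart τ ≤ τ := (K.exists_infPart τ).choose_spec.1

theorem zeta_infPart (τ : P) : K.ζ (K.infPart τ) = K.ζ τ ∩ Set.range Sum.inr :=
  (K.exists_infPart τ).choose_spec.2

theorem infPart_mem_fan (τ : P) : K.infPart τ ∈ K.fan := by
  rintro ⟨v, hv⟩
  rw [K.zeta_infPart] at hv
  obtain ⟨-, w, hw⟩ := hv
  cases hw

section Geometry

variable [Fintype Vf]

/-- For `C = A ∪ B` with `A` a set of vertices and `B` a set of recession rays, the extended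
simplex `Θ_C = σ^A × ℝ_{≥0}^B` inside `ℝ^{V_f ∪ V_∞}`. -/
def extSimplex (C : Set (Vf ⊕ Vinf)) : Set (Vf ⊕ Vinf → ℝ) :=
  {u | (∀ x, 0 ≤ u x) ∧ (∀ x, x ∉ C → u x = 0) ∧ ∑ v : Vf, u (Sum.inl v) = 1}

/-- For `B` a set of recession rays, the cone `ℝ_{≥0}^B` inside `ℝ^{V_f ∪ V_∞}`. -/
def orthant (B : Set (Vf ⊕ Vinf)) : Set (Vf ⊕ Vinf → ℝ) :=
  {w | (∀ x, 0 ≤ w x) ∧ ∀ x, x ∉ B → w x = 0}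

/-- The polyhedron `Θ_τ` attached to `τ`. -/
abbrev Theta (τ : P) : Set (Vf ⊕ Vinf → ℝ) := extSimplex (K.ζ τ)

/-- The elementary gluing: for `τ ≤ η` in `Δ`, a point of `Θ_τ` is identified with the same point
of the face of `Θ_η` that corresponds to `τ`. -/
def Glue (a b : Σ τ : K.cells, K.Theta τ.1) : Prop :=
  a.1.1 ≤ b.1.1 ∧ (a.2 : Vf ⊕ Vinf → ℝ) = b.2

/-- The support `|Δ|`: the polyhedra `Θ_τ`, for `τ` in `Δ`, glued along faces. -/
def Support : Type _ := Quot K.Glue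

/-- The point of `|Δ|` given by a point `u` of `Θ_τ`. -/
def point (τ : P) (hτ : τ ∈ K.cells) (u : Vf ⊕ Vinf → ℝ) (hu : u ∈ K.Theta τ) : K.Support :=
  Quot.mk _ ⟨⟨τ, hτ⟩, ⟨u, hu⟩⟩

end Geometry

/-- The elementary gluing of the cones of the recession fan. -/
def FanGlue (a b : Σ ρ : K.fan, orthant (K.ζ ρ.1)) : Prop :=
  a.1.1 ≤ b.1.1 ∧ (a.2 : Vf ⊕ Vinf → ℝ) = b.2

/-- The support `|Υ|` of the recession fan: the cones `ℝ_{≥0}^{ζ ρ}`, for `ρ` in `Υ`, glued along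
faces. -/
def FanSupport : Type _ := Quot K.FanGlue

/-- The point of `|Υ|` given by a point `w` of the cone of `ρ`. -/
def fanPoint (ρ : P) (hρ : ρ ∈ K.fan) (w : Vf ⊕ Vinf → ℝ) (hw : w ∈ orthant (K.ζ ρ)) :
    K.FanSupport :=
  Quot.mk _ ⟨⟨ρ, hρ⟩, ⟨w, hw⟩⟩

theorem smul_mem_orthant {B : Set (Vf ⊕ Vinf)} {w : Vf ⊕ Vinf → ℝ} (hw : w ∈ orthant B)
    {t : ℝ} (ht : 0 ≤ t) : t • w ∈ orthant B := by
  refine ⟨fun x => ?_, fun x hx => ?_⟩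
  · simpa using mul_nonneg ht (hw.1 x)
  · simp [hw.2 x hx]

section Functions

variable [Fintype Vf]

/-- A half-line `t ↦ origin + t • dir`, `t ≥ 0`, in a cell `Θ_τ` of `|Δ|`; its nonzero direction is
a point of the cone of `τ_∞`. -/
structure HalfLine where
  cell : P
  cell_mem : cell ∈ K.cells
  origin : Vf ⊕ Vinf → ℝ
  origin_mem : origin ∈ K.Theta cell
  dir : Vf ⊕ Vinf → ℝ
  dir_mem : dir ∈ orthant (K.ζ (K.infPart cell))
  dir_ne_zero : dir ≠ 0

namespace HalfLine

variable {K}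

theorem mem_Theta (l : K.HalfLine) {t : ℝ} (ht : 0 ≤ t) :
    l.origin + t • l.dir ∈ K.Theta l.cell := by
  have hd : ∀ x, x ∉ K.ζ l.cell ∩ Set.range Sum.inr → l.dir x = 0 := fun x hx =>
    l.dir_mem.2 x (by rwa [K.zeta_infPart])
  refine ⟨fun x => ?_, fun x hx => ?_, ?_⟩
  · simpa using add_nonneg (l.origin_mem.1 x) (mul_nonneg ht (l.dir_mem.1 x))
  · simp [l.origin_mem.2.1 x hx, hd x fun h => hx h.1]
  · have h0 : ∀ v : Vf, l.dir (Sum.inl v) = 0 := fun v => hd _ (by simp)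
    simpa [h0] using l.origin_mem.2.2

/-- The point of `|Δ|` at parameter `t ≥ 0` on the half-line. -/
def pt (l : K.HalfLine) (t : ℝ) (ht : 0 ≤ t) : K.Support :=
  K.point l.cell l.cell_mem (l.origin + t • l.dir) (l.mem_Theta ht)

/-- The point at parameter `t ≥ 0` on the corresponding half-line of `|Υ|`, which is issued from
the origin. -/
noncomputable def fanPt (l : K.HalfLine) (t : ℝ) (ht : 0 ≤ t) : K.FanSupport :=
  K.fanPoint (K.infPart l.cell) (K.infPart_mem_fan l.cell) (t • l.dir)
    (smul_mem_orthant l.dir_mem ht)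

/-- Two half-lines of `|Δ|` are parallel if they correspond to the same half-line issued from the
origin of `|Υ|`. The half-lines are parametrized, and the parametrizations are required to
correspond as well, so that slopes can be compared; this is harmless as every half-line is
considered with all its linear parametrizations. -/
def Parallel (l l' : K.HalfLine) : Prop :=
  ∀ (t : ℝ) (ht : 0 ≤ t), l.fanPt t ht = l'.fanPt t ht

/-- `F` has slope `s` near infinity along the half-line `l`. -/
def HasSlopeAtInfinity (F : K.Support → ℝ) (l : K.HalfLine) (s : ℝ) : Prop :=
  ∃ (c t₀ : ℝ), ∀ (t : ℝ) (ht : 0 ≤ t), t₀ ≤ t → F (l.pt t ht) = c + t * s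

end HalfLine

variable [Fintype Vinf]

/-- An integral `ℚ`-affine refinement of `Δ`: an integral `ℚ`-affine refinement `R τ` of each
polyhedron `Θ_τ`, `τ` in `Δ`, such that for `τ ≤ η` in `Δ` the refinement `R η` induces `R τ` on
the face `Θ_τ` of `Θ_η`. -/
structure IsIntQRefinement (R : K.cells → Set (Set (Vf ⊕ Vinf → ℝ))) : Prop where
  refinement : ∀ τ : K.cells, IsIntQRefinementOf (R τ) (K.Theta τ.1)
  compatible : ∀ τ η : K.cells, τ.1 ≤ η.1 → R τ = {σ ∈ R η | σ ⊆ K.Theta τ.1}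

/-- `F : |Δ| → ℝ` is piecewise integral `ℚ`-affine: for some integral `ℚ`-affine refinement of `Δ`,
its restriction to each cell of the refinement is integral `ℚ`-affine. -/
def IsPiecewiseIntQAffine (F : K.Support → ℝ) : Prop :=
  ∃ R : K.cells → Set (Set (Vf ⊕ Vinf → ℝ)), K.IsIntQRefinement R ∧
    ∀ τ : K.cells, ∀ σ ∈ R τ, ∃ L : (Vf ⊕ Vinf → ℝ) → ℝ, IsIntQAffine L ∧
      ∀ (u : Vf ⊕ Vinf → ℝ) (hu : u ∈ K.Theta τ.1), u ∈ σ → F (K.point τ.1 τ.2 u hu) = L u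

/-- `F : |Δ| → ℝ` has the same slope near infinity along any two parallel half-lines. -/
def SameSlopes (F : K.Support → ℝ) : Prop :=
  ∀ l l' : K.HalfLine, l.Parallel l' →
    ∃ s : ℝ, l.HasSlopeAtInfinity F s ∧ l'.HasSlopeAtInfinity F s

/-- The tropical function field `Rat(|Δ|)`, as a set of functions from `|Δ|` to the tropical
semifield `ℝ ∪ {∞}` (with `min` as addition and `+` as multiplication, both taken pointwise): the
constant function `∞`, and all piecewise integral `ℚ`-affine functions which have the same slope
near infinity along parallel half-lines. -/
def Rat : Set (K.Support → Tropical (WithTop ℝ)) :=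
  {G | (∀ x, G x = Tropical.trop ⊤) ∨
    ∃ F : K.Support → ℝ, K.IsPiecewiseIntQAffine F ∧ K.SameSlopes F ∧
      ∀ x, G x = Tropical.trop (F x : WithTop ℝ)}

end Functions

end AbstractComplex

/-! ### Semifields of functions over `𝕋ℚ` -/

/-- The semifield `𝕋ℚ = (ℚ ∪ {∞}, min, +)`. -/
abbrev TQ : Type := Tropical (WithTop ℚ)

/-- The inclusion of `𝕋ℚ` in `𝕋 = (ℝ ∪ {∞}, min, +)`. -/
noncomputable def TQ.toReal : TQ →+* Tropical (WithTop ℝ) where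
  toFun a := Tropical.trop ((Tropical.untrop a).map ((↑) : ℚ → ℝ))
  map_zero' := rfl
  map_one' := by
    apply Tropical.injective_untrop
    change WithTop.map _ ((0 : ℚ) : WithTop ℚ) = ((0 : ℝ) : WithTop ℝ)
    simp
  map_mul' a b := by
    apply Tropical.injective_untrop
    change WithTop.map ((↑) : ℚ → ℝ) (Tropical.untrop a + Tropical.untrop b) =
      WithTop.map ((↑) : ℚ → ℝ) (Tropical.untrop a) + WithTop.map ((↑) : ℚ → ℝ) (Tropical.untrop b)
    exact WithTop.map_add (Rat.castHom ℝ) _ _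
  map_add' a b := by
    apply Tropical.injective_untrop
    have h : Monotone (WithTop.map ((↑) : ℚ → ℝ)) :=
      WithTop.monotone_map_iff.2 Rat.cast_mono
    exact h.map_min

section Semifields

variable {X : Type*}

/-- The inclusion of `𝕋ℚ` in the functions from `X` to `𝕋`, as constant functions. -/
noncomputable def constHom (X : Type*) : TQ →+* (X → Tropical (WithTop ℝ)) :=
  (Pi.constRingHom X (Tropical (WithTop ℝ))).comp TQ.toReal

/-- A set of functions from `X` to `𝕋` is a semifield over `𝕋ℚ` for the pointwise operations
`min` and `+`: it contains the constants from `𝕋ℚ` (so the neutral elements `∞` and `0`), is closed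
under both operations, and each element other than `∞` has an inverse. -/
structure IsSemifieldOverTQ (S : Set (X → Tropical (WithTop ℝ))) : Prop where
  const_mem : ∀ a : TQ, constHom X a ∈ S
  add_mem : ∀ F ∈ S, ∀ G ∈ S, F + G ∈ S
  mul_mem : ∀ F ∈ S, ∀ G ∈ S, F * G ∈ S
  exists_inv : ∀ F ∈ S, F ≠ 0 → ∃ G ∈ S, F * G = 1
  zero_ne_one : (0 : X → Tropical (WithTop ℝ)) ≠ 1

/-- `𝕋ℚ(s₁, …, s_r)`: the fractions `p(s₁, …, s_r) / q(s₁, …, s_r)` of polynomial expressions over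
`𝕋ℚ` whose denominator is not the zero element `∞`. -/
def fractions {r : ℕ} (s : Fin r → X → Tropical (WithTop ℝ)) :
    Set (X → Tropical (WithTop ℝ)) :=
  {F | ∃ p q : MvPolynomial (Fin r) TQ, q.eval₂ (constHom X) s ≠ 0 ∧
    F * q.eval₂ (constHom X) s = p.eval₂ (constHom X) s}

/-- `S` is finitely generated as a semifield over `𝕋ℚ`: `S = 𝕋ℚ(s₁, …, s_r)` for some
`s₁, …, s_r` in `S`. -/
def IsFinitelyGeneratedOverTQ (S : Set (X → Tropical (WithTop ℝ))) : Prop :=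
  ∃ (r : ℕ) (s : Fin r → X → Tropical (WithTop ℝ)), (∀ i, s i ∈ S) ∧ S = fractions s

end Semifields

end TropicalFF

/-! A function is piecewise integral ℚ-affine exactly when one finite hyperplane arrangement in the
common coordinate space makes it affine on the cells cut out of every Θ_τ. Arrangements can be
merged, so the semifield axioms follow easily, and the content is finite generation.

The generators are the functions `bump ρ`, one for each ρ in Π. If ζ(ρ) is a single point, `bump ρ`
is a coordinate, so the generators yield every integral ℚ-affine function of the coordinates. The
others tell apart cells of Δ with the same vertices and rays, which coordinates cannot separate.

Let F be affine, equal to L, on a cell σ of a subdivision of Θ_τ. The generators express a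
nonnegative function `defect` on |Δ| that vanishes exactly on σ. The main estimate
`exists_le_add_mul_defect` says F ≤ L + N · defect everywhere for some N, with equality on σ. The
minimum of these bounds over the finitely many σ is F (`mem_of_isRational`).

On each polyhedron of a common subdivision the estimate compares affine functions. By Farkas
(`exists_nat_mul_ge`) it suffices that F ≤ L where the defect vanishes, and that F grows no faster
than L in recession directions where the defect does not grow. The first holds since F = L on σ. In
the second case the direction is also a recession direction of σ, and the slope condition on
parallel half-lines makes the two slopes equal. -/

namespace TropicalFF

/-! ### Farkas' lemma and a bound for affine functions on polyhedra. -/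

section Farkas

variable {E : Type*} [AddCommGroup E] [Module ℝ E]

/-- Farkas' lemma for finitely many linear functionals. -/
theorem farkas_fin (n : ℕ) (c : Fin n → E →ₗ[ℝ] ℝ) (f : E →ₗ[ℝ] ℝ)
    (h : ∀ x, (∀ i, 0 ≤ c i x) → 0 ≤ f x) :
    ∃ a : Fin n → ℝ, (∀ i, 0 ≤ a i) ∧ ∀ x, f x = ∑ i, a i * c i x := by
  induction n generalizing f with
  | zero =>
    refine ⟨fun i => 0, fun i => le_rfl, fun x => ?_⟩
    have h1 := h x (fun i => i.elim0)
    have h2 := h (-x) (fun i => i.elim0)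
    rw [map_neg] at h2
    simp only [Finset.univ_eq_empty, Finset.sum_empty]
    linarith
  | succ n ih =>
    by_cases hf : ∀ x, (∀ i : Fin n, 0 ≤ c i.castSucc x) → 0 ≤ f x
    · obtain ⟨a, ha, hfa⟩ := ih (fun i => c i.castSucc) f hf
      refine ⟨Fin.snoc a 0, fun i => ?_, fun x => ?_⟩
      · refine Fin.lastCases ?_ (fun j => ?_) i
        · simp
        · simpa using ha j
      · simp [Fin.sum_univ_castSucc, hfa x]
    · push Not at hf
      obtain ⟨x₀, hx₀, hfx₀⟩ := hf
      have hlast : c (Fin.last n) x₀ < 0 := by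
        by_contra hc
        refine absurd (h x₀ fun i => ?_) (not_le.2 hfx₀)
        exact Fin.lastCases (not_lt.1 hc) hx₀ i
      -- With the last functional normalized to -1 at `z`, the map x ↦ x + c_last(x) z projects onto
      -- the kernel of c_last. The induction hypothesis is applied to the pullbacks of the
      -- functionals along this projection.
      obtain ⟨z, hz, hfz, hlz⟩ : ∃ z, (∀ i : Fin n, 0 ≤ c i.castSucc z) ∧ f z < 0 ∧
          c (Fin.last n) z = -1 := by
        refine ⟨(-(c (Fin.last n) x₀))⁻¹ • x₀, fun i => ?_, ?_, ?_⟩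
        · rw [map_smul, smul_eq_mul]
          exact mul_nonneg (inv_nonneg.2 (by linarith)) (hx₀ i)
        · rw [map_smul, smul_eq_mul]
          exact mul_neg_of_pos_of_neg (inv_pos.2 (by linarith)) hfx₀
        · rw [map_smul, smul_eq_mul, inv_neg, neg_mul, inv_mul_cancel₀ hlast.ne]
      obtain ⟨a, ha, hfa⟩ := ih
        (fun i => c i.castSucc + c i.castSucc z • c (Fin.last n)) (f + f z • c (Fin.last n))
        (fun x hx => by
          have := h (x + c (Fin.last n) x • z) fun i => by
            refine Fin.lastCases ?_ (fun j => ?_) i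
            · simp [hlz]
            · simpa [mul_comm] using hx j
          simpa [mul_comm] using this)
      -- Undoing the projection forces this last coefficient; it is nonnegative because `f z < 0`.
      refine ⟨Fin.snoc a (∑ i, a i * c i.castSucc z - f z), fun i => ?_, fun x => ?_⟩
      · refine Fin.lastCases ?_ (fun j => ?_) i
        · simp only [Fin.snoc_last]
          have := Finset.sum_nonneg fun i (_ : i ∈ Finset.univ) => mul_nonneg (ha i) (hz i)
          linarith
        · simpa using ha j
      · have := hfa x
        simp only [LinearMap.add_apply, LinearMap.smul_apply, smul_eq_mul, mul_add,
          Finset.sum_add_distrib] at this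
        simp only [Fin.sum_univ_castSucc, Fin.snoc_castSucc, Fin.snoc_last, sub_mul,
          Finset.sum_mul]
        have h3 : ∀ i : Fin n, a i * (c i.castSucc z * c (Fin.last n) x) =
            a i * c i.castSucc z * c (Fin.last n) x := fun i => (mul_assoc _ _ _).symm
        simp only [h3] at this
        linarith

/-- On a polyhedron, an affine function `f` which is nonpositive on the zero locus of a nonnegative
affine function `b`, also at infinity, is bounded by a multiple of `b`. -/
theorem exists_nat_mul_ge {κ : Type*} [Finite κ] (c : κ → E →ₗ[ℝ] ℝ) (γ : κ → ℝ)
    (f b : E →ₗ[ℝ] ℝ) (f₀ b₀ : ℝ)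
    (h0 : ∀ u, (∀ i, 0 ≤ c i u + γ i) → 0 ≤ b u + b₀)
    (h1 : ∀ u, (∀ i, 0 ≤ c i u + γ i) → b u + b₀ = 0 → f u + f₀ ≤ 0)
    (h2 : ∀ w, (∀ i, 0 ≤ c i w) → b w ≤ 0 → f w ≤ 0) :
    ∃ N : ℕ, ∀ u, (∀ i, 0 ≤ c i u + γ i) → f u + f₀ ≤ N * (b u + b₀) := by
  obtain ⟨n, ⟨e⟩⟩ := Finite.exists_equiv_fin κ
  let hom : (E →ₗ[ℝ] ℝ) → ℝ → (E × ℝ →ₗ[ℝ] ℝ) := fun g g₀ =>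
    g.comp (LinearMap.fst ℝ E ℝ) + g₀ • LinearMap.snd ℝ E ℝ
  have hhom : ∀ g g₀ x t, hom g g₀ (x, t) = g x + g₀ * t := fun g g₀ x t => by simp [hom]
  -- Homogenize with an extra variable t and apply Farkas on the cone t ≥ 0, -b ≥ 0, c_i ≥ 0. Points
  -- with t > 0 rescale to the polyhedron (`h0`, `h1`); points with t = 0 are recession directions
  -- (`h2`). The multiplier of -b bounds N from below.
  obtain ⟨a, ha, hfa⟩ := farkas_fin (n + 2)
    (Fin.cons (LinearMap.snd ℝ E ℝ) (Fin.cons (-hom b b₀)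
      (fun i => hom (c (e.symm i)) (γ (e.symm i))) : Fin (n + 1) → (E × ℝ →ₗ[ℝ] ℝ)) :
      Fin (n + 2) → (E × ℝ →ₗ[ℝ] ℝ)) (-hom f f₀) (by
      rintro ⟨x, t⟩ hx
      have ht : 0 ≤ t := by simpa using hx 0
      have hb : b x + b₀ * t ≤ 0 := by
        have := hx (Fin.succ 0)
        simpa only [Fin.cons_succ, Fin.cons_zero, LinearMap.neg_apply, hhom,
          Left.nonneg_neg_iff] using this
      have hc : ∀ i, 0 ≤ c i x + γ i * t := fun i => by
        have := hx (Fin.succ (Fin.succ (e i)))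
        simpa only [Fin.cons_succ, hhom, Equiv.symm_apply_apply] using this
      rw [LinearMap.neg_apply, hhom, Left.nonneg_neg_iff]
      rcases ht.eq_or_lt with rfl | ht
      · simp only [mul_zero, add_zero] at *
        exact h2 x hc hb
      · have key : ∀ (g : E →ₗ[ℝ] ℝ) (g₀ : ℝ), g (t⁻¹ • x) + g₀ = t⁻¹ * (g x + g₀ * t) := by
          intro g g₀
          rw [map_smul, smul_eq_mul]
          field_simp
        have hmem : ∀ i, 0 ≤ c i (t⁻¹ • x) + γ i := fun i => by
          rw [key]
          exact mul_nonneg (inv_nonneg.2 ht.le) (hc i)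
        have hb0 : b (t⁻¹ • x) + b₀ = 0 := by
          refine le_antisymm ?_ (h0 _ hmem)
          rw [key]
          exact mul_nonpos_of_nonneg_of_nonpos (inv_nonneg.2 ht.le) hb
        have := h1 _ hmem hb0
        rw [key] at this
        exact nonpos_of_mul_nonpos_right this (inv_pos.2 ht))
  obtain ⟨N, hN⟩ := exists_nat_ge (a (Fin.succ 0))
  refine ⟨N, fun u hu => ?_⟩
  have hfu := hfa (u, 1)
  rw [Fin.sum_univ_succ, Fin.sum_univ_succ] at hfu
  simp only [Fin.cons_succ, Fin.cons_zero, LinearMap.neg_apply, hhom, mul_one,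
    LinearMap.snd_apply] at hfu
  have hs : 0 ≤ ∑ i : Fin n, a i.succ.succ * (c (e.symm i) u + γ (e.symm i)) :=
    Finset.sum_nonneg fun i _ => mul_nonneg (ha _) (hu _)
  have h3 := mul_le_mul_of_nonneg_right hN (h0 u hu)
  have h4 := ha 0
  linarith

end Farkas

/-! ### Closed cells of an arrangement. -/

section SignCells

variable {ι : Type*}

/-- The closed cell of the point `x` in the arrangement of the zero loci of the functions in
`A`. -/
def signCell (A : Set ((ι → ℝ) → ℝ)) (x : ι → ℝ) : Set (ι → ℝ) :=
  {u | ∀ L ∈ A, (0 ≤ L x → 0 ≤ L u) ∧ (L x ≤ 0 → L u ≤ 0)}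

/-- The functions whose nonnegativity defines `signCell A x`. -/
def signConstraints (A : Set ((ι → ℝ) → ℝ)) (x : ι → ℝ) : Set ((ι → ℝ) → ℝ) :=
  {L ∈ A | 0 ≤ L x} ∪ Neg.neg '' {L ∈ A | L x ≤ 0}

theorem self_mem_signCell (A : Set ((ι → ℝ) → ℝ)) (x : ι → ℝ) : x ∈ signCell A x :=
  fun _ _ => ⟨id, id⟩

theorem signCell_anti {A B : Set ((ι → ℝ) → ℝ)} (h : A ⊆ B) (x : ι → ℝ) :
    signCell B x ⊆ signCell A x :=
  fun _ hu L hL => hu L (h hL)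

theorem signCell_subset {A : Set ((ι → ℝ) → ℝ)} {x y : ι → ℝ} (h : x ∈ signCell A y) :
    signCell A x ⊆ signCell A y :=
  fun _ hu L hL => ⟨fun hy => (hu L hL).1 ((h L hL).1 hy), fun hy => (hu L hL).2 ((h L hL).2 hy)⟩

theorem signCell_eq (A : Set ((ι → ℝ) → ℝ)) (x : ι → ℝ) :
    signCell A x = {u | ∀ L ∈ signConstraints A x, 0 ≤ L u} := by
  ext u
  constructor
  · rintro hu L (⟨hL, hx⟩ | ⟨M, ⟨hM, hx⟩, rfl⟩)
    · exact (hu L hL).1 hx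
    · simpa using (hu M hM).2 hx
  · intro hu L hL
    refine ⟨fun hx => hu L (Or.inl ⟨hL, hx⟩), fun hx => ?_⟩
    simpa using hu (-L) (Or.inr ⟨L, ⟨hL, hx⟩, rfl⟩)

theorem signConstraints_finite {A : Set ((ι → ℝ) → ℝ)} (hA : A.Finite) (x : ι → ℝ) :
    (signConstraints A x).Finite :=
  (hA.subset (Set.sep_subset _ _)).union ((hA.subset (Set.sep_subset _ _)).image _)

theorem finite_range_signCell {A : Set ((ι → ℝ) → ℝ)} (hA : A.Finite) :
    (Set.range (signCell A)).Finite := by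
  have := hA.to_subtype
  -- The cell of a point depends only on its sign vector, and there are finitely many sign vectors.
  let G : (A → SignType) → Set (ι → ℝ) := fun s =>
    {u | ∀ L : A, (0 ≤ s L → 0 ≤ L.1 u) ∧ (s L ≤ 0 → L.1 u ≤ 0)}
  refine (Set.finite_range G).subset ?_
  rintro _ ⟨x, rfl⟩
  refine ⟨fun L => SignType.sign (L.1 x), ?_⟩
  ext u
  simp only [G, Set.mem_ofPred_eq, sign_nonneg_iff, sign_nonpos_iff, Subtype.forall]
  rfl

end SignCells

/-! ### Integral ℚ-affine functions, and arrangement cells as a polyhedral complex. -/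

section Polyhedra

variable {ι : Type*} [Fintype ι]

namespace IsIntQAffine

theorem const (q : ℚ) : IsIntQAffine fun _ : ι → ℝ => (q : ℝ) :=
  ⟨0, q, fun u => by simp⟩

theorem coord (i : ι) : IsIntQAffine fun u : ι → ℝ => u i := by
  classical
  exact ⟨Pi.single i 1, 0, fun u => by simp [Pi.single_apply]⟩

theorem add {L M : (ι → ℝ) → ℝ} (hL : IsIntQAffine L) (hM : IsIntQAffine M) :
    IsIntQAffine (L + M) := by
  obtain ⟨m, γ, h⟩ := hL
  obtain ⟨m', γ', h'⟩ := hM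
  refine ⟨m + m', γ + γ', fun u => ?_⟩
  simp only [Pi.add_apply, h, h', Int.cast_add, Rat.cast_add, add_mul, Finset.sum_add_distrib]
  ring

theorem neg {L : (ι → ℝ) → ℝ} (hL : IsIntQAffine L) : IsIntQAffine (-L) := by
  obtain ⟨m, γ, h⟩ := hL
  refine ⟨-m, -γ, fun u => ?_⟩
  simp only [Pi.neg_apply, h, Int.cast_neg, Rat.cast_neg, neg_mul, Finset.sum_neg_distrib]
  ring

theorem sub {L M : (ι → ℝ) → ℝ} (hL : IsIntQAffine L) (hM : IsIntQAffine M) :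
    IsIntQAffine (L - M) := by
  rw [sub_eq_add_neg]
  exact hL.add hM.neg

theorem sum {κ : Type*} (s : Finset κ) {L : κ → (ι → ℝ) → ℝ} (hL : ∀ k ∈ s, IsIntQAffine (L k)) :
    IsIntQAffine fun u => ∑ k ∈ s, L k u := by
  classical
  induction s using Finset.induction_on with
  | empty => simpa using const (ι := ι) 0
  | insert a s ha ih =>
    simp only [Finset.sum_insert ha]
    exact (hL a (by simp)).add (ih fun k hk => hL k (by simp [hk]))

theorem exists_linearMap {L : (ι → ℝ) → ℝ} (hL : IsIntQAffine L) :
    ∃ (φ : (ι → ℝ) →ₗ[ℝ] ℝ) (c : ℝ), ∀ u, L u = φ u + c := by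
  obtain ⟨m, γ, h⟩ := hL
  refine ⟨∑ i, (m i : ℝ) • LinearMap.proj i, γ, fun u => ?_⟩
  simp [h, LinearMap.sum_apply]

end IsIntQAffine

theorem isIntQPolyhedron_iff {σ : Set (ι → ℝ)} :
    IsIntQPolyhedron σ ↔ ∃ D : Set ((ι → ℝ) → ℝ), D.Finite ∧ (∀ L ∈ D, IsIntQAffine L) ∧
      σ = {u | ∀ L ∈ D, 0 ≤ L u} := by
  constructor
  · rintro ⟨r, L, hL, rfl⟩
    exact ⟨Set.range L, Set.finite_range L, by rintro _ ⟨i, rfl⟩; exact hL i, by simp⟩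
  · rintro ⟨D, hD, hL, rfl⟩
    have := hD.to_subtype
    obtain ⟨n, ⟨e⟩⟩ := Finite.exists_equiv_fin D
    refine ⟨n, fun i => (e.symm i).1, fun i => hL _ (e.symm i).2, ?_⟩
    ext u
    simp only [Set.mem_ofPred_eq]
    refine ⟨fun h i => h _ (e.symm i).2, fun h L hLD => ?_⟩
    simpa using h (e ⟨L, hLD⟩)

theorem isIntQAffine_of_mem_signConstraints {A : Set ((ι → ℝ) → ℝ)}
    (hA : ∀ L ∈ A, IsIntQAffine L) {x : ι → ℝ} {L : (ι → ℝ) → ℝ}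
    (hL : L ∈ signConstraints A x) : IsIntQAffine L := by
  rcases hL with ⟨hL, -⟩ | ⟨M, ⟨hM, -⟩, rfl⟩
  · exact hA L hL
  · exact (hA M hM).neg

theorem isIntQPolyhedron_signCell {A : Set ((ι → ℝ) → ℝ)} (hA : A.Finite)
    (hA' : ∀ L ∈ A, IsIntQAffine L) (x : ι → ℝ) : IsIntQPolyhedron (signCell A x) :=
  isIntQPolyhedron_iff.2 ⟨_, signConstraints_finite hA x,
    fun _ => isIntQAffine_of_mem_signConstraints hA', signCell_eq A x⟩

/-- A point is relatively interior to its own cell: functions nonzero at `x` keep their sign nearby,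
and those zero at `x` vanish on the whole line through `x` and `u`. -/
theorem exists_extrapolation {A : Set ((ι → ℝ) → ℝ)} (hA : A.Finite)
    (hA' : ∀ L ∈ A, IsIntQAffine L) {x u : ι → ℝ} (hu : u ∈ signCell A x) :
    ∃ ε : ℝ, 0 < ε ∧ x - ε • (u - x) ∈ signCell A x := by
  have hev : ∀ L ∈ A, ∀ᶠ ε : ℝ in nhdsWithin 0 (Set.Ioi 0),
      (0 ≤ L x → 0 ≤ L (x - ε • (u - x))) ∧ (L x ≤ 0 → L (x - ε • (u - x)) ≤ 0) := by
    intro L hL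
    obtain ⟨φ, c, hφ⟩ := (hA' L hL).exists_linearMap
    have hval : ∀ ε : ℝ, L (x - ε • (u - x)) = L x - ε * (L u - L x) := fun ε => by
      simp only [hφ, map_sub, map_smul, smul_eq_mul]; ring
    have hcont : Filter.Tendsto (fun ε : ℝ => L x - ε * (L u - L x)) (nhdsWithin 0 (Set.Ioi 0))
        (nhds (L x)) := by
      have : Continuous fun ε : ℝ => L x - ε * (L u - L x) := by fun_prop
      have h := this.tendsto 0
      simp only [zero_mul, sub_zero] at h
      exact h.mono_left nhdsWithin_le_nhds
    rcases lt_trichotomy (L x) 0 with hx | hx | hx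
    · filter_upwards [hcont.eventually_lt_const hx] with ε hε
      exact ⟨fun h => absurd hx (not_lt.2 h), fun _ => (hval ε).trans_le hε.le⟩
    · have h0 : L u = 0 := le_antisymm ((hu L hL).2 hx.le) ((hu L hL).1 hx.ge)
      refine Filter.Eventually.of_forall fun ε => ?_
      rw [hval, hx, h0]
      simp
    · filter_upwards [hcont.eventually_const_lt hx] with ε hε
      exact ⟨fun _ => hε.le.trans_eq (hval ε).symm, fun h => absurd hx (not_lt.2 h)⟩
  obtain ⟨ε, hε, hpos⟩ := (((Filter.eventually_all_finite hA).2 hev).and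
    self_mem_nhdsWithin).exists
  exact ⟨ε, hpos, hε⟩

theorem exists_eq_signCell_of_isFace {A : Set ((ι → ℝ) → ℝ)} (hA : A.Finite)
    (hA' : ∀ L ∈ A, IsIntQAffine L) {y : ι → ℝ} {φ : Set (ι → ℝ)} (h : IsFace φ (signCell A y)) :
    ∃ x ∈ φ, φ = signCell A x := by
  obtain ⟨hne, a, rfl⟩ := h
  set φ := {u ∈ signCell A y | ∀ w ∈ signCell A y, ∑ i, a i * w i ≤ ∑ i, a i * u i} with hφ
  have hlin : ∀ (s t : ℝ) (u w : ι → ℝ), ∑ i, a i * (s • u + t • w) i =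
      s * ∑ i, a i * u i + t * ∑ i, a i * w i := fun s t u w => by
    simp only [Pi.add_apply, Pi.smul_apply, smul_eq_mul, mul_add, Finset.sum_add_distrib,
      Finset.mul_sum]
    congr 1 <;> exact Finset.sum_congr rfl fun i _ => by ring
  let Z : (ι → ℝ) → Set ((ι → ℝ) → ℝ) := fun x => {L ∈ A | L x = 0}
  have hfin : (Z '' φ).Finite := hA.finite_subsets.subset (by
    rintro _ ⟨x, -, rfl⟩
    exact Set.sep_subset _ _)
  -- A point of the face with the fewest vanishing functions is relatively interior to it. Averaging
  -- it with any `u` in the face stays in the face, so by minimality every function vanishing at `x`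
  -- vanishes at `u`.
  obtain ⟨_, ⟨⟨x, hx, rfl⟩, hmin⟩⟩ := hfin.exists_minimal (hne.image Z)
  refine ⟨x, hx, Set.Subset.antisymm (fun u hu => ?_) fun u hu => ?_⟩
  · have hmid : ∀ L ∈ A, L ((1 / 2 : ℝ) • x + (1 / 2 : ℝ) • u) = (L x + L u) / 2 := by
      intro L hL
      obtain ⟨ψ, c, hψ⟩ := (hA' L hL).exists_linearMap
      simp only [hψ, map_add, map_smul, smul_eq_mul]
      ring
    have hz : (1 / 2 : ℝ) • x + (1 / 2 : ℝ) • u ∈ φ := by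
      refine ⟨fun L hL => ?_, fun w hw => ?_⟩
      · rw [hmid L hL]
        have h1 := hx.1 L hL
        have h2 := hu.1 L hL
        exact ⟨fun h => by linarith [h1.1 h, h2.1 h], fun h => by linarith [h1.2 h, h2.2 h]⟩
      · rw [hlin]
        linarith [hx.2 w hw, hu.2 w hw]
    have hzero : ∀ L ∈ A, L x = 0 → L u = 0 := by
      intro L hL hLx
      have hsub : Z ((1 / 2 : ℝ) • x + (1 / 2 : ℝ) • u) ⊆ Z x := by
        rintro M ⟨hM, hM0⟩
        refine ⟨hM, ?_⟩
        rw [hmid M hM] at hM0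
        rcases le_total 0 (M y) with h | h
        · linarith [(hx.1 M hM).1 h, (hu.1 M hM).1 h]
        · linarith [(hx.1 M hM).2 h, (hu.1 M hM).2 h]
      have h0 := (hmin ⟨_, hz, rfl⟩ hsub ⟨hL, hLx⟩).2
      rw [hmid L hL] at h0
      linarith
    intro L hL
    rcases eq_or_ne (L x) 0 with h0 | h0
    · simp [hzero L hL h0]
    · rcases le_total 0 (L y) with h | h
      · have := (hx.1 L hL).1 h
        exact ⟨fun _ => (hu.1 L hL).1 h, fun h' => absurd (le_antisymm h' this) h0⟩
      · have := (hx.1 L hL).2 h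
        exact ⟨fun h' => absurd (le_antisymm this h') h0, fun _ => (hu.1 L hL).2 h⟩
  -- A linear functional maximal at `x` cannot decrease towards `u`, since it would then increase on
  -- the extrapolated side.
  · obtain ⟨ε, hε, hz⟩ := exists_extrapolation hA hA' hu
    refine ⟨signCell_subset hx.1 hu, fun w hw => (hx.2 w hw).trans ?_⟩
    have := hx.2 _ (signCell_subset hx.1 hz)
    have he : x - ε • (u - x) = (1 + ε) • x + (-ε) • u := by module
    rw [he, hlin] at this
    nlinarith

/-- Sum the functions L whose signs at `x` and `y` are not strictly equal, each multiplied by the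
sign of L at `x`. The sum is nonnegative on the cell of `x` and vanishes there exactly on the cell
of `y`, so its negative exposes the intersection. -/
theorem isFace_inter_signCell {A : Set ((ι → ℝ) → ℝ)} (hA : A.Finite)
    (hA' : ∀ L ∈ A, IsIntQAffine L) {x y : ι → ℝ} (h : (signCell A x ∩ signCell A y).Nonempty) :
    IsFace (signCell A x ∩ signCell A y) (signCell A x) := by
  classical
  refine ⟨h, ?_⟩
  have hsg : ∀ L ∈ A, ∀ u ∈ signCell A x, 0 ≤ (SignType.sign (L x) : ℝ) * L u := by
    intro L hL u hu
    rcases lt_trichotomy (L x) 0 with h0 | h0 | h0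
    · simpa [sign_neg h0] using (hu L hL).2 h0.le
    · simp [h0]
    · simpa [sign_pos h0] using (hu L hL).1 h0.le
  set D : Finset ((ι → ℝ) → ℝ) := hA.toFinset.filter fun L => L x * L y ≤ 0 with hD
  let g : (ι → ℝ) → ℝ := fun u => ∑ L ∈ D, (SignType.sign (L x) : ℝ) * L u
  have hDA : ∀ L ∈ D, L ∈ A := fun L hL => by simpa using (Finset.mem_filter.1 hL).1
  have hg0 : ∀ u ∈ signCell A x, 0 ≤ g u := fun u hu =>
    Finset.sum_nonneg fun L hL => hsg L (hDA L hL) u hu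
  have hgzero : ∀ u ∈ signCell A x, (g u = 0 ↔ u ∈ signCell A y) := by
    intro u hu
    rw [Finset.sum_eq_zero_iff_of_nonneg fun L hL => hsg L (hDA L hL) u hu]
    constructor
    · intro h0 L hL
      rcases lt_trichotomy (L x) 0 with hx | hx | hx
      · rcases lt_or_ge (L y) 0 with hy | hy
        · exact ⟨fun h => absurd hy (not_lt.2 h), fun _ => (hu L hL).2 hx.le⟩
        · have := h0 L (by simp [hD, hL, mul_nonpos_of_nonpos_of_nonneg hx.le hy])
          simp only [sign_neg hx, SignType.coe_neg_one, neg_mul, one_mul, neg_eq_zero] at this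
          simp [this]
      · simp [le_antisymm ((hu L hL).2 hx.le) ((hu L hL).1 hx.ge)]
      · rcases lt_or_ge 0 (L y) with hy | hy
        · exact ⟨fun _ => (hu L hL).1 hx.le, fun h => absurd hy (not_lt.2 h)⟩
        · have := h0 L (by simp [hD, hL, mul_nonpos_of_nonneg_of_nonpos hx.le hy])
          simp only [sign_pos hx, SignType.coe_one, one_mul] at this
          simp [this]
    · intro huy L hL
      have hLA := hDA L hL
      have hxy := (Finset.mem_filter.1 hL).2
      rcases lt_trichotomy (L x) 0 with hx | hx | hx
      · have hy : 0 ≤ L y := by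
          by_contra hy
          exact absurd hxy (not_le.2 (mul_pos_of_neg_of_neg hx (not_le.1 hy)))
        simp [le_antisymm ((hu L hLA).2 hx.le) ((huy L hLA).1 hy)]
      · simp [hx]
      · have hy : L y ≤ 0 := by
          by_contra hy
          exact absurd hxy (not_le.2 (mul_pos hx (not_le.1 hy)))
        simp [le_antisymm ((huy L hLA).2 hy) ((hu L hLA).1 hx.le)]
  choose! m γ hm using hA'
  have hlin : ∃ (a : ι → ℝ) (c : ℝ), ∀ u, ∑ i, a i * u i = c - g u := by
    refine ⟨fun i => -∑ L ∈ D, (SignType.sign (L x) : ℝ) * m L i,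
      ∑ L ∈ D, (SignType.sign (L x) : ℝ) * γ L, fun u => ?_⟩
    have : g u = ∑ L ∈ D, ((SignType.sign (L x) : ℝ) * (∑ i, (m L i : ℝ) * u i) +
        (SignType.sign (L x) : ℝ) * γ L) :=
      Finset.sum_congr rfl fun L hL => by rw [hm L (hDA L hL) u, mul_add]
    rw [this, Finset.sum_add_distrib]
    simp only [Finset.mul_sum, neg_mul, Finset.sum_mul, Finset.sum_neg_distrib]
    rw [Finset.sum_comm]
    simp only [mul_assoc]
    ring
  obtain ⟨a, c, ha⟩ := hlin
  obtain ⟨z, hzx, hzy⟩ := h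
  refine ⟨a, ?_⟩
  ext u
  simp only [ha, Set.mem_inter_iff, Set.mem_ofPred_eq]
  refine and_congr_right fun hu => ?_
  rw [← hgzero u hu]
  constructor
  · intro h0 w hw
    linarith [hg0 w hw]
  · intro hall
    have := hall z hzx
    rw [(hgzero z hzx).2 hzy] at this
    exact le_antisymm (by linarith) (hg0 u hu)

theorem isIntQComplex_signCell {A : Set ((ι → ℝ) → ℝ)} (hA : A.Finite)
    (hA' : ∀ L ∈ A, IsIntQAffine L) {T : Set (ι → ℝ)} (hT : ∀ x ∈ T, signCell A x ⊆ T) :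
    IsIntQComplex (signCell A '' T) where
  finite := (finite_range_signCell hA).subset (Set.image_subset_range _ _)
  nonempty := by
    rintro _ ⟨x, -, rfl⟩
    exact ⟨x, self_mem_signCell A x⟩
  polyhedron := by
    rintro _ ⟨x, -, rfl⟩
    exact isIntQPolyhedron_signCell hA hA' x
  face_mem := by
    rintro _ ⟨y, hy, rfl⟩ φ hφ
    obtain ⟨x, hx, hφx⟩ := exists_eq_signCell_of_isFace hA hA' hφ
    obtain ⟨-, a, rfl⟩ := hφ
    exact ⟨x, hT y hy hx.1, hφx.symm⟩
  inter_face := by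
    rintro _ ⟨x, -, rfl⟩ _ ⟨y, -, rfl⟩ h
    refine ⟨isFace_inter_signCell hA hA' h, ?_⟩
    rw [Set.inter_comm] at h ⊢
    exact isFace_inter_signCell hA hA' h

end Polyhedra

theorem sUnion_isFace {ι : Type*} [Fintype ι] {σ : Set (ι → ℝ)} (h : σ.Nonempty) :
    IsFace σ σ ∧ ⋃₀ {φ | IsFace φ σ} = σ := by
  have hσ : IsFace σ σ := ⟨h, 0, by simp⟩
  refine ⟨hσ, Set.Subset.antisymm (Set.sUnion_subset ?_) (Set.subset_sUnion_of_mem hσ)⟩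
  rintro _ ⟨-, a, rfl⟩
  exact Set.sep_subset _ _

/-! ### Carriers of points in the complex, and slopes of sums and minima. -/

namespace AbstractComplex

variable {Vf Vinf P : Type*} [PartialOrder P] [OrderBot P] (K : AbstractComplex Vf Vinf P)

theorem zeta_mono {τ η : P} (h : τ ≤ η) : K.ζ τ ⊆ K.ζ η :=
  (K.le_iff h le_rfl).1 h

theorem mem_cells_mono {τ η : P} (h : τ ≤ η) (hτ : τ ∈ K.cells) : η ∈ K.cells := by
  obtain ⟨v, hv⟩ := hτ
  exact ⟨v, K.zeta_mono h hv⟩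

theorem eq_of_zeta_eq {τ σ σ' : P} (h : σ ≤ τ) (h' : σ' ≤ τ) (he : K.ζ σ = K.ζ σ') : σ = σ' :=
  (K.bijOn_Icc τ).injOn ⟨bot_le, h⟩ ⟨bot_le, h'⟩ he

theorem exists_zeta_eq_support {ρ : P} {w : Vf ⊕ Vinf → ℝ} (hw : ∀ x, x ∉ K.ζ ρ → w x = 0) :
    ∃ σ, σ ≤ ρ ∧ K.ζ σ = {x | w x ≠ 0} := by
  obtain ⟨σ, hσ, h⟩ := (K.bijOn_Icc ρ).surjOn
    (show {x | w x ≠ 0} ∈ 𝒫 (K.ζ ρ) from fun x hx => by_contra fun h => hx (hw x h))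
  exact ⟨σ, hσ.2, h⟩

variable [Fintype Vf]

theorem extSimplex_mono {B C : Set (Vf ⊕ Vinf)} (h : B ⊆ C) : extSimplex B ⊆ extSimplex C :=
  fun _ hu => ⟨hu.1, fun x hx => hu.2.1 x fun hB => hx (h hB), hu.2.2⟩

theorem extSimplex_nonempty {C : Set (Vf ⊕ Vinf)} {v : Vf} (hv : Sum.inl v ∈ C) :
    (extSimplex C).Nonempty := by
  classical
  refine ⟨Pi.single (Sum.inl v) 1, fun x => ?_, fun x hx => ?_, ?_⟩
  · by_cases h : x = Sum.inl v
    · subst h; simp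
    · simp [Pi.single_eq_of_ne h]
  · exact Pi.single_eq_of_ne (by rintro rfl; exact hx hv) _
  · simp [Pi.single_apply]

theorem Theta_nonempty {τ : P} (hτ : τ ∈ K.cells) : (K.Theta τ).Nonempty := by
  obtain ⟨v, hv⟩ := hτ
  exact extSimplex_nonempty hv

/-- The carrier of `u`. It lies in Δ because the vertex coordinates of `u` sum to 1 and so cannot
all vanish. -/
theorem exists_cell_zeta_eq_support {τ : P} {u : Vf ⊕ Vinf → ℝ} (hu : u ∈ K.Theta τ) :
    ∃ σ ≤ τ, σ ∈ K.cells ∧ u ∈ K.Theta σ ∧ K.ζ σ = {x | u x ≠ 0} := by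
  obtain ⟨σ, hσ, h⟩ := K.exists_zeta_eq_support hu.2.1
  refine ⟨σ, hσ, ?_, ⟨hu.1, fun x hx => ?_, hu.2.2⟩, h⟩
  · by_contra hc
    have h0 : ∀ v : Vf, u (Sum.inl v) = 0 := fun v => by
      by_contra hv
      exact hc ⟨v, h ▸ hv⟩
    have := hu.2.2
    simp [h0] at this
  · rw [h] at hx
    simpa using hx

theorem point_eq {τ η : P} (h : τ ≤ η) (hτ : τ ∈ K.cells) (hη : η ∈ K.cells)
    {u : Vf ⊕ Vinf → ℝ} (hu : u ∈ K.Theta τ) (hu' : u ∈ K.Theta η) :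
    K.point τ hτ u hu = K.point η hη u hu' :=
  Quot.sound ⟨h, rfl⟩

theorem exists_point_eq (x : K.Support) :
    ∃ τ, ∃ hτ : τ ∈ K.cells, ∃ u, ∃ hu : u ∈ K.Theta τ, K.point τ hτ u hu = x := by
  induction x using Quot.inductionOn with
  | h a => exact ⟨a.1.1, a.1.2, a.2.1, a.2.2, rfl⟩

instance [Nonempty Vf] : Nonempty K.Support := by
  obtain ⟨v⟩ := ‹Nonempty Vf›
  obtain ⟨τ, hτ, -⟩ := K.existsUnique_singleton (Sum.inl v)
  have hτ : τ ∈ K.cells := ⟨v, hτ.symm ▸ rfl⟩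
  obtain ⟨u, hu⟩ := K.Theta_nonempty hτ
  exact ⟨K.point τ hτ u hu⟩

namespace HalfLine

variable {K} {F G : K.Support → ℝ} {l : K.HalfLine} {s t : ℝ}

theorem HasSlopeAtInfinity.neg (hF : l.HasSlopeAtInfinity F s) :
    l.HasSlopeAtInfinity (-F) (-s) := by
  obtain ⟨c, t₀, h⟩ := hF
  exact ⟨-c, t₀, fun t ht htt => by rw [Pi.neg_apply, h t ht htt]; ring⟩

theorem HasSlopeAtInfinity.add (hF : l.HasSlopeAtInfinity F s) (hG : l.HasSlopeAtInfinity G t) :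
    l.HasSlopeAtInfinity (F + G) (s + t) := by
  obtain ⟨c, t₀, h⟩ := hF
  obtain ⟨d, t₁, h'⟩ := hG
  refine ⟨c + d, max t₀ t₁, fun r hr hrr => ?_⟩
  rw [Pi.add_apply, h r hr ((le_max_left _ _).trans hrr), h' r hr ((le_max_right _ _).trans hrr)]
  ring

theorem HasSlopeAtInfinity.inf (hF : l.HasSlopeAtInfinity F s) (hG : l.HasSlopeAtInfinity G t) :
    l.HasSlopeAtInfinity (F ⊓ G) (s ⊓ t) := by
  wlog hst : s ≤ t generalizing F G s t
  · rw [inf_comm F, inf_comm s]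
    exact this hG hF (le_of_not_ge hst)
  obtain ⟨c, t₀, h⟩ := hF
  obtain ⟨d, t₁, h'⟩ := hG
  rw [inf_eq_left.2 hst]
  rcases hst.eq_or_lt with rfl | hst
  · refine ⟨c ⊓ d, max t₀ t₁, fun r hr hrr => ?_⟩
    rw [Pi.inf_apply, h r hr ((le_max_left _ _).trans hrr), h' r hr ((le_max_right _ _).trans hrr)]
    exact min_add_add_right c d (r * s)
  -- Beyond (c - d) / (t - s) the line of smaller slope is the lower one.
  · refine ⟨c, max (max t₀ t₁) ((c - d) / (t - s)), fun r hr hrr => ?_⟩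
    have h2 : (c - d) / (t - s) ≤ r := (le_max_right _ _).trans hrr
    have h1 : max t₀ t₁ ≤ r := (le_max_left _ _).trans hrr
    rw [Pi.inf_apply, h r hr ((le_max_left _ _).trans h1), h' r hr ((le_max_right _ _).trans h1)]
    rw [div_le_iff₀ (sub_pos.2 hst)] at h2
    exact inf_eq_left.2 (by linarith)

end HalfLine

/-! ### Piecewise affine functions via one global arrangement. -/

/-- `F` is integral `ℚ`-affine on each cell that a finite arrangement of integral `ℚ`-affine
hyperplanes cuts out of the `Θ_τ`. -/
def IsCellwiseAffine (F : K.Support → ℝ) [Fintype Vinf] : Prop :=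
  ∃ A B : Set ((Vf ⊕ Vinf → ℝ) → ℝ), A.Finite ∧ B.Finite ∧
    (∀ L ∈ A, IsIntQAffine L) ∧ (∀ L ∈ B, IsIntQAffine L) ∧
    ∀ (τ : P) (hτ : τ ∈ K.cells), ∀ x ∈ K.Theta τ, ∃ L ∈ B,
      ∀ (u : Vf ⊕ Vinf → ℝ) (hu : u ∈ K.Theta τ), u ∈ signCell A x →
        F (K.point τ hτ u hu) = L u

variable {K} [Fintype Vinf] {F G : K.Support → ℝ}

namespace IsCellwiseAffine

theorem const (q : ℚ) : K.IsCellwiseAffine fun _ => (q : ℝ) :=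
  ⟨∅, {fun _ => (q : ℝ)}, Set.finite_empty, Set.finite_singleton _, by simp,
    by rintro _ rfl; exact .const q, fun _ _ _ _ => ⟨_, rfl, fun _ _ _ => rfl⟩⟩

theorem neg (hF : K.IsCellwiseAffine F) : K.IsCellwiseAffine (-F) := by
  obtain ⟨A, B, hA, hB, hA', hB', h⟩ := hF
  refine ⟨A, Neg.neg '' B, hA, hB.image _, hA', ?_, fun τ hτ x hx => ?_⟩
  · rintro _ ⟨L, hL, rfl⟩
    exact (hB' L hL).neg
  · obtain ⟨L, hL, hFL⟩ := h τ hτ x hx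
    exact ⟨-L, ⟨L, hL, rfl⟩, fun u hu hux => by simp [hFL u hu hux]⟩

theorem add (hF : K.IsCellwiseAffine F) (hG : K.IsCellwiseAffine G) :
    K.IsCellwiseAffine (F + G) := by
  obtain ⟨A, B, hA, hB, hA', hB', h⟩ := hF
  obtain ⟨C, D, hC, hD, hC', hD', h'⟩ := hG
  refine ⟨A ∪ C, Set.image2 (· + ·) B D, hA.union hC, hB.image2 _ hD, ?_, ?_, fun τ hτ x hx => ?_⟩
  · rintro L (hL | hL)
    exacts [hA' L hL, hC' L hL]
  · rintro _ ⟨L, hL, M, hM, rfl⟩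
    exact (hB' L hL).add (hD' M hM)
  · obtain ⟨L, hL, hFL⟩ := h τ hτ x hx
    obtain ⟨M, hM, hGM⟩ := h' τ hτ x hx
    refine ⟨L + M, ⟨L, hL, M, hM, rfl⟩, fun u hu hux => ?_⟩
    simp [hFL u hu (signCell_anti Set.subset_union_left x hux),
      hGM u hu (signCell_anti Set.subset_union_right x hux)]

theorem inf (hF : K.IsCellwiseAffine F) (hG : K.IsCellwiseAffine G) :
    K.IsCellwiseAffine (F ⊓ G) := by
  obtain ⟨A, B, hA, hB, hA', hB', h⟩ := hF
  obtain ⟨C, D, hC, hD, hC', hD', h'⟩ := hG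
  -- Adding the differences L - M to the arrangement fixes, on each cell, which of the two affine
  -- pieces is smaller.
  refine ⟨(A ∪ C) ∪ Set.image2 (· - ·) B D, B ∪ D, (hA.union hC).union (hB.image2 _ hD),
    hB.union hD, ?_, ?_, fun τ hτ x hx => ?_⟩
  · rintro _ ((hL | hL) | ⟨L, hL, M, hM, rfl⟩)
    exacts [hA' _ hL, hC' _ hL, (hB' L hL).sub (hD' M hM)]
  · rintro L (hL | hL)
    exacts [hB' L hL, hD' L hL]
  · obtain ⟨L, hL, hFL⟩ := h τ hτ x hx
    obtain ⟨M, hM, hGM⟩ := h' τ hτ x hx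
    have hLM : L - M ∈ (A ∪ C) ∪ Set.image2 (· - ·) B D := Or.inr ⟨L, hL, M, hM, rfl⟩
    have hF' := fun u hu (hux : u ∈ signCell ((A ∪ C) ∪ Set.image2 (· - ·) B D) x) =>
      hFL u hu (signCell_anti (Set.subset_union_left.trans Set.subset_union_left) x hux)
    have hG' := fun u hu (hux : u ∈ signCell ((A ∪ C) ∪ Set.image2 (· - ·) B D) x) =>
      hGM u hu (signCell_anti (Set.subset_union_right.trans Set.subset_union_left) x hux)
    rcases le_total (L x) (M x) with hle | hle
    · refine ⟨L, Or.inl hL, fun u hu hux => ?_⟩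
      have := (hux _ hLM).2 (by simpa using hle)
      rw [Pi.inf_apply, hF' u hu hux, hG' u hu hux]
      exact inf_eq_left.2 (by simpa using this)
    · refine ⟨M, Or.inr hM, fun u hu hux => ?_⟩
      have := (hux _ hLM).1 (by simpa using hle)
      rw [Pi.inf_apply, hF' u hu hux, hG' u hu hux]
      exact inf_eq_right.2 (by simpa using this)

end IsCellwiseAffine

/-- Once the arrangement contains the coordinates and the equation of the simplex, each extended
simplex is a union of cells. -/
theorem exists_signCell_subset_extSimplex :
    ∃ T : Set ((Vf ⊕ Vinf → ℝ) → ℝ), T.Finite ∧ (∀ L ∈ T, IsIntQAffine L) ∧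
      ∀ C, T ⊆ C → ∀ B : Set (Vf ⊕ Vinf), ∀ x ∈ extSimplex B, signCell C x ⊆ extSimplex B := by
  let S : (Vf ⊕ Vinf → ℝ) → ℝ := (fun u => ∑ v : Vf, u (Sum.inl v)) - fun _ => ((1 : ℚ) : ℝ)
  refine ⟨insert S (Set.range fun x u => u x), (Set.finite_range _).insert _, ?_,
    fun C hC B x hx u hu => ?_⟩
  · rintro _ (rfl | ⟨x, rfl⟩)
    · exact (IsIntQAffine.sum _ fun v _ => .coord _).sub (.const 1)
    · exact .coord x
  · have hcoord : ∀ y, (fun u : Vf ⊕ Vinf → ℝ => u y) ∈ C := fun y => hC (Or.inr ⟨y, rfl⟩)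
    refine ⟨fun y => (hu _ (hcoord y)).1 (hx.1 y), fun y hy => ?_, ?_⟩
    · have h0 := hx.2.1 y hy
      exact le_antisymm ((hu _ (hcoord y)).2 h0.le) ((hu _ (hcoord y)).1 h0.ge)
    · have h0 : S x = 0 := by simp [S, hx.2.2]
      have hS : S ∈ C := hC (Or.inl rfl)
      have h1 : S u = 0 := le_antisymm ((hu _ hS).2 h0.le) ((hu _ hS).1 h0.ge)
      simpa [S, sub_eq_zero] using h1

/-- The same arrangement subdivides every Θ_τ, so compatibility along faces is automatic. -/
theorem isPiecewiseIntQAffine_of_isCellwiseAffine (h : K.IsCellwiseAffine F) :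
    K.IsPiecewiseIntQAffine F := by
  obtain ⟨A, B, hA, -, hA', hB', h⟩ := h
  obtain ⟨T, hT₀, hT', hT⟩ := exists_signCell_subset_extSimplex (Vf := Vf) (Vinf := Vinf)
  have hAC : A ⊆ A ∪ T := Set.subset_union_left
  have hC : (A ∪ T).Finite := hA.union hT₀
  have hC' : ∀ L ∈ A ∪ T, IsIntQAffine L := by
    rintro L (hL | hL)
    exacts [hA' L hL, hT' L hL]
  replace hT : ∀ τ : P, ∀ x ∈ K.Theta τ, signCell (A ∪ T) x ⊆ K.Theta τ :=
    fun τ x hx => hT _ Set.subset_union_right _ x hx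
  generalize A ∪ T = C at *
  refine ⟨fun τ => signCell C '' K.Theta τ.1, ⟨fun τ => ⟨isIntQComplex_signCell hC hC' (hT τ.1),
    ?_, ?_⟩, fun τ η hle => ?_⟩, ?_⟩
  · rw [(sUnion_isFace (K.Theta_nonempty τ.2)).2]
    refine Set.Subset.antisymm (Set.sUnion_subset ?_) fun x hx =>
      ⟨_, ⟨x, hx, rfl⟩, self_mem_signCell C x⟩
    rintro _ ⟨x, hx, rfl⟩
    exact hT τ.1 x hx
  · rintro _ ⟨x, hx, rfl⟩
    exact ⟨_, (sUnion_isFace (K.Theta_nonempty τ.2)).1, hT τ.1 x hx⟩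
  · ext σ
    constructor
    · rintro ⟨x, hx, rfl⟩
      exact ⟨⟨x, extSimplex_mono (K.zeta_mono hle) hx, rfl⟩, hT τ.1 x hx⟩
    · rintro ⟨⟨x, hx, rfl⟩, hsub⟩
      exact ⟨x, hsub (self_mem_signCell C x), rfl⟩
  · rintro τ _ ⟨x, hx, rfl⟩
    obtain ⟨L, hL, hFL⟩ := h τ.1 τ.2 x hx
    exact ⟨L, hB' L hL, fun u hu hux => hFL u hu (signCell_anti hAC x hux)⟩

/-- Collect the inequalities defining all polyhedra of all the refinements: the arrangement cell of
a point then lies in every such polyhedron containing the point. -/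
theorem isCellwiseAffine_of_isPiecewiseIntQAffine [Finite P] (h : K.IsPiecewiseIntQAffine F) :
    K.IsCellwiseAffine F := by
  obtain ⟨R, hR, h⟩ := h
  choose! L hL hFL using h
  choose! D hD hD' hDσ using fun τ σ hσ =>
    isIntQPolyhedron_iff.1 ((hR.refinement τ).1.polyhedron σ hσ)
  refine ⟨⋃ τ, ⋃ σ ∈ R τ, D τ σ, ⋃ τ, ⋃ σ ∈ R τ, {L τ σ},
    Set.finite_iUnion fun τ => (hR.refinement τ).1.finite.biUnion fun σ hσ => hD τ σ hσ,
    Set.finite_iUnion fun τ => (hR.refinement τ).1.finite.biUnion fun σ _ =>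
      Set.finite_singleton _, ?_, ?_, fun τ hτ x hx => ?_⟩
  · simp only [Set.mem_iUnion]
    rintro M ⟨τ, σ, hσ, hM⟩
    exact hD' τ σ hσ M hM
  · simp only [Set.mem_iUnion]
    rintro _ ⟨τ, σ, hσ, rfl⟩
    exact hL τ σ hσ
  · have hcov := (hR.refinement ⟨τ, hτ⟩).2.1
    rw [(sUnion_isFace (K.Theta_nonempty hτ)).2] at hcov
    rw [← hcov] at hx
    obtain ⟨σ, hσ, hxσ⟩ := hx
    refine ⟨L ⟨τ, hτ⟩ σ, Set.mem_iUnion.2 ⟨_, Set.mem_iUnion₂.2 ⟨σ, hσ, rfl⟩⟩,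
      fun u hu hux => hFL ⟨τ, hτ⟩ σ hσ u hu ?_⟩
    rw [hDσ _ σ hσ] at hxσ ⊢
    exact fun M hM => (hux M (Set.mem_iUnion.2 ⟨_, Set.mem_iUnion₂.2 ⟨σ, hσ, hM⟩⟩)).1 (hxσ M hM)

/-- The finite elements of `Rat(|Δ|)`, as real-valued functions. -/
def IsRational (F : K.Support → ℝ) : Prop := K.IsPiecewiseIntQAffine F ∧ K.SameSlopes F

namespace IsRational

theorem const (q : ℚ) : IsRational (K := K) fun _ => (q : ℝ) :=
  ⟨isPiecewiseIntQAffine_of_isCellwiseAffine (.const q),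
    fun _ _ _ => ⟨0, ⟨q, 0, by simp⟩, ⟨q, 0, by simp⟩⟩⟩

variable [Finite P]

theorem neg (hF : IsRational F) : IsRational (-F) := by
  refine ⟨isPiecewiseIntQAffine_of_isCellwiseAffine
    (isCellwiseAffine_of_isPiecewiseIntQAffine hF.1).neg, fun l l' h => ?_⟩
  obtain ⟨s, h1, h2⟩ := hF.2 l l' h
  exact ⟨_, h1.neg, h2.neg⟩

theorem add (hF : IsRational F) (hG : IsRational G) : IsRational (F + G) := by
  refine ⟨isPiecewiseIntQAffine_of_isCellwiseAffine
    ((isCellwiseAffine_of_isPiecewiseIntQAffine hF.1).add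
      (isCellwiseAffine_of_isPiecewiseIntQAffine hG.1)), fun l l' h => ?_⟩
  obtain ⟨s, h1, h2⟩ := hF.2 l l' h
  obtain ⟨t, h3, h4⟩ := hG.2 l l' h
  exact ⟨_, h1.add h3, h2.add h4⟩

theorem inf (hF : IsRational F) (hG : IsRational G) : IsRational (F ⊓ G) := by
  refine ⟨isPiecewiseIntQAffine_of_isCellwiseAffine
    ((isCellwiseAffine_of_isPiecewiseIntQAffine hF.1).inf
      (isCellwiseAffine_of_isPiecewiseIntQAffine hG.1)), fun l l' h => ?_⟩
  obtain ⟨s, h1, h2⟩ := hF.2 l l' h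
  obtain ⟨t, h3, h4⟩ := hG.2 l l' h
  exact ⟨_, h1.inf h3, h2.inf h4⟩

end IsRational

end AbstractComplex

/-! ### Passage to tropical values; the semifield axioms. -/

section TropicalFunctions

variable {X : Type*}

/-- A real-valued function, as a function to `ℝ ∪ {∞}`. -/
def tropReal (F : X → ℝ) : X → Tropical (WithTop ℝ) := fun x => Tropical.trop (F x : WithTop ℝ)

theorem tropReal_add (F G : X → ℝ) : tropReal (F + G) = tropReal F * tropReal G := rfl

theorem tropReal_inf (F G : X → ℝ) : tropReal (F ⊓ G) = tropReal F + tropReal G :=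
  funext fun x => congrArg Tropical.trop (WithTop.coe_min (F x) (G x))

theorem tropReal_zero : tropReal (0 : X → ℝ) = 1 := rfl

theorem tropReal_ne_zero [Nonempty X] (F : X → ℝ) : tropReal F ≠ 0 := fun h => by
  obtain ⟨x⟩ := ‹Nonempty X›
  exact WithTop.coe_ne_top (Tropical.injective_trop (congrFun h x))

theorem constHom_coe (q : ℚ) :
    constHom X (Tropical.trop (q : WithTop ℚ)) = tropReal fun _ => (q : ℝ) := rfl

end TropicalFunctions

namespace AbstractComplex

variable {Vf Vinf P : Type*} [PartialOrder P] [OrderBot P] {K : AbstractComplex Vf Vinf P}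
  [Fintype Vf] [Fintype Vinf]

theorem mem_Rat_iff {G : K.Support → Tropical (WithTop ℝ)} :
    G ∈ K.Rat ↔ G = 0 ∨ ∃ F, IsRational F ∧ G = tropReal F := by
  refine or_congr ⟨fun h => funext h, fun h x => congrFun h x⟩ ?_
  exact ⟨fun ⟨F, h1, h2, h3⟩ => ⟨F, ⟨h1, h2⟩, funext h3⟩,
    fun ⟨F, ⟨h1, h2⟩, h3⟩ => ⟨F, h1, h2, fun x => congrFun h3 x⟩⟩

theorem isSemifieldOverTQ_Rat [Nonempty Vf] [Finite P] : IsSemifieldOverTQ K.Rat where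
  const_mem a := by
    rw [mem_Rat_iff]
    induction a using Tropical.tropRec with
    | h a =>
      induction a using WithTop.recTopCoe with
      | top => exact Or.inl (map_zero (constHom K.Support))
      | coe q => exact Or.inr ⟨_, .const q, constHom_coe q⟩
  add_mem F hF G hG := by
    rw [mem_Rat_iff] at *
    rcases hF with rfl | ⟨F, hF, rfl⟩
    · simpa using hG
    rcases hG with rfl | ⟨G, hG, rfl⟩
    · exact Or.inr ⟨F, hF, by simp⟩
    · exact Or.inr ⟨_, hF.inf hG, (tropReal_inf F G).symm⟩
  mul_mem F hF G hG := by
    rw [mem_Rat_iff] at *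
    rcases hF with rfl | ⟨F, hF, rfl⟩
    · simp
    rcases hG with rfl | ⟨G, hG, rfl⟩
    · simp
    · exact Or.inr ⟨_, hF.add hG, rfl⟩
  exists_inv F hF hF0 := by
    obtain ⟨f, hf, rfl⟩ := (mem_Rat_iff.1 hF).resolve_left hF0
    refine ⟨_, mem_Rat_iff.2 (Or.inr ⟨_, hf.neg, rfl⟩), ?_⟩
    rw [← tropReal_add, add_neg_cancel, tropReal_zero]
  zero_ne_one := (tropReal_ne_zero 0).symm

end AbstractComplex
-- Sets of real functions closed under tropical operations.
/-- A set of real-valued functions which is closed under the operations of a tropical semifield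
over `𝕋ℚ`. -/
structure IsTropicallyClosed {X : Type*} (S : Set (X → ℝ)) : Prop where
  const_mem : ∀ q : ℚ, (fun _ => (q : ℝ)) ∈ S
  add_mem : ∀ F ∈ S, ∀ G ∈ S, F + G ∈ S
  neg_mem : ∀ F ∈ S, -F ∈ S
  inf_mem : ∀ F ∈ S, ∀ G ∈ S, F ⊓ G ∈ S

namespace IsTropicallyClosed

variable {X : Type*} {S : Set (X → ℝ)} (hS : IsTropicallyClosed S)
include hS

theorem zero_mem : (0 : X → ℝ) ∈ S := by
  simpa [Pi.zero_def] using hS.const_mem 0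

theorem sum_mem {κ : Type*} (s : Finset κ) {F : κ → X → ℝ} (hF : ∀ k ∈ s, F k ∈ S) :
    ∑ k ∈ s, F k ∈ S := by
  classical
  induction s using Finset.induction_on with
  | empty => simpa using hS.zero_mem
  | insert a s ha ih =>
    rw [Finset.sum_insert ha]
    exact hS.add_mem _ (hF a (by simp)) _ (ih fun k hk => hF k (by simp [hk]))

theorem nsmul_mem {F : X → ℝ} (hF : F ∈ S) (n : ℕ) : n • F ∈ S := by
  induction n with
  | zero => simpa using hS.zero_mem
  | succ n ih =>
    rw [succ_nsmul]
    exact hS.add_mem _ ih _ hF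

theorem zsmul_mem {F : X → ℝ} (hF : F ∈ S) (n : ℤ) : n • F ∈ S := by
  obtain ⟨m, rfl | rfl⟩ := n.eq_nat_or_neg
  · simpa using hS.nsmul_mem hF m
  · simpa using hS.neg_mem _ (hS.nsmul_mem hF m)

theorem affine_mem {ι : Type*} [Fintype ι] {f : X → ι → ℝ} (hf : ∀ i, (fun x => f x i) ∈ S)
    {L : (ι → ℝ) → ℝ} (hL : IsIntQAffine L) : L ∘ f ∈ S := by
  obtain ⟨m, γ, h⟩ := hL
  have : L ∘ f = ∑ i, m i • (fun x => f x i) + fun _ => (γ : ℝ) := by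
    ext x
    simp [h]
  rw [this]
  exact hS.add_mem _ (hS.sum_mem _ fun i _ => hS.zsmul_mem (hf i) _) _ (hS.const_mem γ)

end IsTropicallyClosed

/-! ### Parallel half-lines and the generators `bump ρ`. -/

namespace AbstractComplex

variable {Vf Vinf P : Type*} [PartialOrder P] [OrderBot P] (K : AbstractComplex Vf Vinf P)

theorem infPart_mono {σ τ η : P} (h : σ ≤ K.infPart τ) (h' : σ ≤ η) : σ ≤ K.infPart η := by
  refine (K.le_iff h' (K.infPart_le η)).2 ?_
  rw [zeta_infPart]
  refine Set.subset_inter (K.zeta_mono h') ((K.zeta_mono h).trans ?_)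
  rw [zeta_infPart]
  exact Set.inter_subset_right

/-- Some element of ζ(ρ) lies outside ζ(τ), where `w` vanishes. This makes `bump` compatible with
the gluing, and forces its slope to be 0 in directions carried by cones not above ρ. -/
theorem ciInf_zeta_eq_zero [Finite (Vf ⊕ Vinf)] {ρ τ η : P} {w : Vf ⊕ Vinf → ℝ}
    (hw : ∀ x, 0 ≤ w x) (hsupp : ∀ x, x ∉ K.ζ τ → w x = 0) (hρ : ρ ≤ η) (hτ : τ ≤ η)
    (h : ¬ρ ≤ τ) : ⨅ x : K.ζ ρ, w x = 0 := by
  rw [K.le_iff hρ hτ, Set.not_subset] at h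
  obtain ⟨x, hx, hxτ⟩ := h
  refine le_antisymm ?_ (Real.iInf_nonneg fun y => hw y)
  exact (ciInf_le (Set.finite_range _).bddBelow (⟨x, hx⟩ : K.ζ ρ)).trans_eq (hsupp x hxτ)

variable [Fintype Vf]

/-- The coordinates of a point of `|Δ|`. -/
def coords : K.Support → Vf ⊕ Vinf → ℝ :=
  Quot.lift (fun a => a.2.1) fun _ _ h => h.2

@[simp]
theorem coords_point (τ : P) (hτ : τ ∈ K.cells) (u : Vf ⊕ Vinf → ℝ) (hu : u ∈ K.Theta τ) :
    K.coords (K.point τ hτ u hu) = u := rfl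

namespace HalfLine

variable {K}

theorem Parallel.dir_eq_and_exists_le {l l' : K.HalfLine} (h : l.Parallel l') :
    l.dir = l'.dir ∧ ∃ σ, σ ≤ K.infPart l.cell ∧ σ ≤ K.infPart l'.cell ∧
      K.ζ σ = {x | l.dir x ≠ 0} := by
  -- The carrier and the vector of a point of |Υ| are invariant under gluing, so equality in the
  -- quotient can be read off from them.
  let S : K.FanSupport → P × (Vf ⊕ Vinf → ℝ) :=
    Quot.lift (fun a => ((K.exists_zeta_eq_support a.2.2.2).choose, a.2.1)) (by
      rintro a b ⟨hle, hab⟩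
      have ha := (K.exists_zeta_eq_support a.2.2.2).choose_spec
      have hb := (K.exists_zeta_eq_support b.2.2.2).choose_spec
      refine Prod.ext ?_ hab
      refine K.eq_of_zeta_eq (ha.1.trans hle) hb.1 ?_
      rw [ha.2, hb.2, hab])
  have hS := congrArg S (h 1 zero_le_one)
  have hdir : (1 : ℝ) • l.dir = (1 : ℝ) • l'.dir := congrArg Prod.snd hS
  rw [one_smul, one_smul] at hdir
  refine ⟨hdir, ?_⟩
  have hl := (K.exists_zeta_eq_support (smul_mem_orthant l.dir_mem zero_le_one).2).choose_spec
  have hl' := (K.exists_zeta_eq_support (smul_mem_orthant l'.dir_mem zero_le_one).2).choose_spec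
  have heq := congrArg Prod.fst hS
  refine ⟨_, hl.1, heq.trans_le hl'.1, ?_⟩
  rw [hl.2]
  simp

theorem parallel_of_le {l l' : K.HalfLine} {σ : P} (h : σ ≤ K.infPart l.cell)
    (h' : σ ≤ K.infPart l'.cell) (hσ : K.ζ σ = {x | l.dir x ≠ 0}) (hdir : l.dir = l'.dir) :
    l.Parallel l' := by
  intro t ht
  have hfan : σ ∈ K.fan := fun hc => K.infPart_mem_fan l.cell (K.mem_cells_mono h hc)
  have hmem : t • l.dir ∈ orthant (K.ζ σ) := by
    refine smul_mem_orthant ⟨l.dir_mem.1, fun x hx => ?_⟩ ht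
    rw [hσ] at hx
    simpa using hx
  have h1 : K.fanPoint σ hfan _ hmem = l.fanPt t ht := Quot.sound ⟨h, rfl⟩
  have h2 : K.fanPoint σ hfan _ hmem = l'.fanPt t ht := Quot.sound ⟨h', by simp [hdir]⟩
  exact h1.symm.trans h2

theorem HasSlopeAtInfinity.unique {F : K.Support → ℝ} {l : K.HalfLine} {s s' : ℝ}
    (h : l.HasSlopeAtInfinity F s) (h' : l.HasSlopeAtInfinity F s') : s = s' := by
  obtain ⟨c, t₀, h⟩ := h
  obtain ⟨d, t₁, h'⟩ := h'
  have key : ∀ t, 0 ≤ t → t₀ ≤ t → t₁ ≤ t → c + t * s = d + t * s' := fun t h0 h1 h2 =>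
    (h t h0 h1).symm.trans (h' t h0 h2)
  have h3 := key (max 0 (max t₀ t₁)) (by simp) (by simp) (by simp)
  have h4 := key (max 0 (max t₀ t₁) + 1) (by positivity)
    (le_add_of_le_of_nonneg (by simp) zero_le_one) (le_add_of_le_of_nonneg (by simp) zero_le_one)
  linarith

end HalfLine

variable [Fintype Vinf]

open Classical in
/-- The function which is the minimum of the coordinates in `ζ ρ` on the `Θ_τ` with `ρ ≤ τ`,
extended by `0`. -/
noncomputable def bump (ρ : P) : K.Support → ℝ :=
  Quot.lift (fun a => if ρ ≤ a.1.1 then ⨅ x : K.ζ ρ, a.2.1 x else 0) (by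
    rintro ⟨τ, u⟩ ⟨η, v⟩ ⟨hle, huv⟩
    simp only at hle huv
    simp only [← huv]
    by_cases h : ρ ≤ τ.1
    · simp [h, h.trans hle]
    · by_cases h' : ρ ≤ η.1
      · simp only [h, h', if_true, if_false]
        exact (K.ciInf_zeta_eq_zero u.2.1 u.2.2.1 h' hle h).symm
      · simp [h, h'])

theorem bump_point_of_le {ρ τ : P} (h : ρ ≤ τ) (hτ : τ ∈ K.cells) {u : Vf ⊕ Vinf → ℝ}
    (hu : u ∈ K.Theta τ) : K.bump ρ (K.point τ hτ u hu) = ⨅ x : K.ζ ρ, u x :=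
  if_pos h

theorem bump_point_of_not_le {ρ τ : P} (h : ¬ρ ≤ τ) (hτ : τ ∈ K.cells) {u : Vf ⊕ Vinf → ℝ}
    (hu : u ∈ K.Theta τ) : K.bump ρ (K.point τ hτ u hu) = 0 :=
  if_neg h

theorem bump_nonneg (ρ : P) (p : K.Support) : 0 ≤ K.bump ρ p := by
  obtain ⟨τ, hτ, u, hu, rfl⟩ := K.exists_point_eq p
  by_cases h : ρ ≤ τ
  · rw [K.bump_point_of_le h]
    exact Real.iInf_nonneg fun x => hu.1 x
  · rw [K.bump_point_of_not_le h]

/-- Since only one ρ has ζ(ρ) = {x}, it lies below every τ whose ζ(τ) contains `x`. -/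
theorem exists_bump_eq_coord (x : Vf ⊕ Vinf) : ∃ ρ, K.bump ρ = fun p => K.coords p x := by
  obtain ⟨ρ, hρ, huniq⟩ := K.existsUnique_singleton x
  refine ⟨ρ, funext fun p => ?_⟩
  obtain ⟨τ, hτ, u, hu, rfl⟩ := K.exists_point_eq p
  rw [coords_point]
  by_cases hx : x ∈ K.ζ τ
  · obtain ⟨σ, hσ, h⟩ := (K.bijOn_Icc τ).surjOn
      (show {x} ∈ 𝒫 (K.ζ τ) from Set.singleton_subset_iff.2 hx)
    obtain rfl := huniq σ h
    rw [K.bump_point_of_le hσ.2]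
    have hx' : ∀ y : K.ζ σ, u y = u x := fun y => by
      have hy : (y : Vf ⊕ Vinf) ∈ ({x} : Set _) := h ▸ y.2
      rw [Set.mem_singleton_iff.1 hy]
    have : Nonempty (K.ζ σ) := ⟨⟨x, h ▸ rfl⟩⟩
    simp only [hx', ciInf_const]
  · rw [K.bump_point_of_not_le (fun h => hx (K.zeta_mono h (hρ ▸ rfl))), hu.2.1 x hx]

variable {K}

theorem isCellwiseAffine_bump (ρ : P) : K.IsCellwiseAffine (K.bump ρ) := by
  refine ⟨Set.range fun (a : (Vf ⊕ Vinf) × (Vf ⊕ Vinf)) => (fun u => u a.1) - (fun u => u a.2),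
    insert (fun _ => ((0 : ℚ) : ℝ)) (Set.range fun x u => u x), Set.finite_range _,
    (Set.finite_range _).insert _, ?_, ?_, fun τ hτ x _ => ?_⟩
  · rintro _ ⟨a, rfl⟩
    exact (IsIntQAffine.coord _).sub (.coord _)
  · rintro _ (rfl | ⟨x, rfl⟩)
    exacts [.const 0, .coord x]
  · have hzero : ∀ f : (u : Vf ⊕ Vinf → ℝ) → u ∈ K.Theta τ → ℝ, (∀ u hu, f u hu = 0) →
        ∃ L ∈ insert (fun _ => ((0 : ℚ) : ℝ)) (Set.range fun x (u : Vf ⊕ Vinf → ℝ) => u x),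
        ∀ u hu, f u hu = L u :=
      fun f hf => ⟨_, Or.inl rfl, fun u hu => by simp [hf]⟩
    by_cases h : ρ ≤ τ
    -- For empty ζ(ρ), that is ρ = ⊥, the real infimum takes its default value 0.
    · rcases (K.ζ ρ).eq_empty_or_nonempty with h0 | h0
      · have : IsEmpty (K.ζ ρ) := Set.isEmpty_coe_sort.2 h0
        obtain ⟨L, hL, hfL⟩ := hzero (fun u hu => K.bump ρ (K.point τ hτ u hu)) fun u hu => by
          rw [K.bump_point_of_le h, Real.iInf_of_isEmpty]
        exact ⟨L, hL, fun u hu _ => hfL u hu⟩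
      · have := h0.to_subtype
        obtain ⟨y, hy⟩ := Finite.exists_min fun y : K.ζ ρ => x y
        refine ⟨_, Or.inr ⟨y, rfl⟩, fun u hu hux => ?_⟩
        rw [K.bump_point_of_le h]
        refine le_antisymm (ciInf_le (Set.finite_range _).bddBelow y) (le_ciInf fun z => ?_)
        have := (hux _ ⟨(z, y), rfl⟩).1 (by simpa using hy z)
        simpa using this
    · obtain ⟨L, hL, hfL⟩ := hzero (fun u hu => K.bump ρ (K.point τ hτ u hu)) fun u hu =>
        K.bump_point_of_not_le h hτ hu
      exact ⟨L, hL, fun u hu _ => hfL u hu⟩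

namespace HalfLine

theorem hasSlopeAtInfinity_bump {l : K.HalfLine} {ρ : P} (h : ρ ≤ l.cell) :
    l.HasSlopeAtInfinity (K.bump ρ) (⨅ x : K.ζ ρ, l.dir x) := by
  rcases (K.ζ ρ).eq_empty_or_nonempty with h0 | h0
  · have : IsEmpty (K.ζ ρ) := Set.isEmpty_coe_sort.2 h0
    refine ⟨0, 0, fun t ht _ => ?_⟩
    rw [HalfLine.pt, K.bump_point_of_le h, Real.iInf_of_isEmpty, Real.iInf_of_isEmpty]
    simp
  · have := h0.to_subtype
    -- The coordinate that is eventually smallest has least slope and, among those, least initial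
    -- value.
    obtain ⟨y, hy⟩ := Finite.exists_min fun y : K.ζ ρ => toLex (l.dir y, l.origin y)
    have hle : ∀ z : K.ζ ρ, l.dir y < l.dir z ∨
        (l.dir y = l.dir z ∧ l.origin y ≤ l.origin z) := fun z => by
      simpa [Prod.Lex.le_iff] using hy z
    have hslope : ⨅ x : K.ζ ρ, l.dir x = l.dir y :=
      le_antisymm (ciInf_le (Set.finite_range _).bddBelow y)
        (le_ciInf fun z => (hle z).elim le_of_lt fun h => h.1.le)
    have hev : ∀ z : K.ζ ρ, ∀ᶠ t : ℝ in Filter.atTop,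
        l.origin y + t * l.dir y ≤ l.origin z + t * l.dir z := fun z => by
      rcases hle z with hlt | ⟨heq, ho⟩
      · filter_upwards [Filter.eventually_ge_atTop
          ((l.origin y - l.origin z) / (l.dir z - l.dir y))] with t ht
        rw [div_le_iff₀ (sub_pos.2 hlt)] at ht
        linarith
      · refine Filter.Eventually.of_forall fun t => ?_
        rw [heq]
        linarith
    obtain ⟨t₀, ht₀⟩ := Filter.eventually_atTop.1 (Filter.eventually_all.2 hev)
    refine ⟨l.origin y, t₀, fun t ht htt => ?_⟩
    rw [HalfLine.pt, K.bump_point_of_le h, hslope]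
    exact le_antisymm (ciInf_le (Set.finite_range _).bddBelow y) (le_ciInf fun z => ht₀ t htt z)

end HalfLine

theorem sameSlopes_bump (ρ : P) : K.SameSlopes (K.bump ρ) := by
  have hzero : ∀ l : K.HalfLine, ¬ρ ≤ l.cell → l.HasSlopeAtInfinity (K.bump ρ) 0 :=
    fun l h => ⟨0, 0, fun t ht _ => by
      rw [HalfLine.pt, K.bump_point_of_not_le h, mul_zero, add_zero]⟩
  -- The carrier σ of the common direction lies below both cells, hence ρ ≰ σ and the direction
  -- vanishes somewhere on ζ(ρ).
  have hmixed : ∀ l l' : K.HalfLine, l.Parallel l' → ρ ≤ l.cell → ¬ρ ≤ l'.cell →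
      l.HasSlopeAtInfinity (K.bump ρ) 0 := by
    intro l l' hp h h'
    obtain ⟨-, σ, hσ, hσ', hsupp⟩ := hp.dir_eq_and_exists_le
    have := HalfLine.hasSlopeAtInfinity_bump h
    rwa [K.ciInf_zeta_eq_zero l.dir_mem.1 (τ := σ) (fun x hx => by rw [hsupp] at hx; simpa using hx)
      h (hσ.trans (K.infPart_le _)) fun hc => h' (hc.trans (hσ'.trans (K.infPart_le _)))] at this
  intro l l' hp
  by_cases h : ρ ≤ l.cell <;> by_cases h' : ρ ≤ l'.cell
  · refine ⟨_, HalfLine.hasSlopeAtInfinity_bump h, ?_⟩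
    rw [hp.dir_eq_and_exists_le.1]
    exact HalfLine.hasSlopeAtInfinity_bump h'
  · exact ⟨0, hmixed l l' hp h h', hzero l' h'⟩
  · exact ⟨0, hzero l h, hmixed l' l (fun t ht => (hp t ht).symm) h' h⟩
  · exact ⟨0, hzero l h, hzero l' h'⟩

theorem isRational_bump (ρ : P) : IsRational (K.bump ρ) :=
  ⟨isPiecewiseIntQAffine_of_isCellwiseAffine (isCellwiseAffine_bump ρ), sameSlopes_bump ρ⟩

theorem isTropicallyClosed_isCellwiseAffine :
    IsTropicallyClosed {F : K.Support → ℝ | K.IsCellwiseAffine F} where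
  const_mem := .const
  add_mem _ hF _ hG := IsCellwiseAffine.add hF hG
  neg_mem _ hF := IsCellwiseAffine.neg hF
  inf_mem _ hF _ hG := IsCellwiseAffine.inf hF hG

theorem _root_.TropicalFF.IsTropicallyClosed.comp_coords_mem {S : Set (K.Support → ℝ)}
    (hS : IsTropicallyClosed S) (hb : ∀ ρ, K.bump ρ ∈ S) {L : (Vf ⊕ Vinf → ℝ) → ℝ}
    (hL : IsIntQAffine L) : L ∘ K.coords ∈ S := by
  refine hS.affine_mem (fun x => ?_) hL
  obtain ⟨ρ, hρ⟩ := K.exists_bump_eq_coord x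
  exact hρ ▸ hb ρ

end AbstractComplex
theorem nonneg_of_forall_nonneg_add_mul {a b : ℝ} (h : ∀ t : ℝ, 0 ≤ t → 0 ≤ a + t * b) :
    0 ≤ b := by
  by_contra hb
  push Not at hb
  have h1 := h (-(|a| + 1) / b) (div_nonneg_of_nonpos (by linarith [abs_nonneg a]) hb.le)
  rw [div_mul_cancel₀ _ hb.ne] at h1
  linarith [le_abs_self a]

/-! ### The defect of a cell, the main estimate, and generation by the `bump ρ`. -/

namespace AbstractComplex

variable {Vf Vinf P : Type*} [PartialOrder P] [OrderBot P] {K : AbstractComplex Vf Vinf P}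
  [Fintype Vf]

/-- The vertex coordinates of `w` are nonnegative with sum 0, hence vanish; thus recession
directions give half-lines. -/
theorem mem_orthant_of_forall_mem_Theta {τ : P} {x w : Vf ⊕ Vinf → ℝ}
    (h : ∀ t : ℝ, 0 ≤ t → x + t • w ∈ K.Theta τ) : w ∈ orthant (K.ζ (K.infPart τ)) := by
  have hx : x ∈ K.Theta τ := by simpa using h 0 le_rfl
  have hnonneg : ∀ y, 0 ≤ w y := fun y =>
    nonneg_of_forall_nonneg_add_mul (a := x y) fun t ht => by simpa using (h t ht).1 y
  have h1 := h 1 zero_le_one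
  rw [one_smul] at h1
  have hsum : ∑ v : Vf, w (Sum.inl v) = 0 := by
    have := h1.2.2
    simp only [Pi.add_apply, Finset.sum_add_distrib, hx.2.2] at this
    linarith
  refine ⟨hnonneg, fun y hy => ?_⟩
  rw [zeta_infPart] at hy
  rcases y with v | r
  · exact (Finset.sum_eq_zero_iff_of_nonneg fun v _ => hnonneg _).1 hsum v (Finset.mem_univ v)
  · have hyτ : Sum.inr r ∉ K.ζ τ := fun h => hy ⟨h, r, rfl⟩
    simpa [hx.2.1 _ hyτ] using h1.2.1 _ hyτ

/-- If `F` agrees with an affine function `L` on a closed cell, then along a recession direction of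
the cell the slopes of `F` and `L` agree. -/
theorem hasSlopeAtInfinity_of_eqOn {F : K.Support → ℝ} (l : K.HalfLine)
    {φ : (Vf ⊕ Vinf → ℝ) →ₗ[ℝ] ℝ} {c : ℝ}
    (h : ∀ t ht, F (l.pt t ht) = φ (l.origin + t • l.dir) + c) :
    l.HasSlopeAtInfinity F (φ l.dir) := by
  refine ⟨φ l.origin + c, 0, fun t ht _ => ?_⟩
  rw [h, map_add, map_smul, smul_eq_mul]
  ring

variable [Fintype Vinf]

/-- A nonnegative function on `|Δ|`, whose zero locus is the part of `Θ_τ` where the functions in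
`D` are nonnegative. -/
noncomputable def defect [Fintype P] (τ : P) (D : Finset ((Vf ⊕ Vinf → ℝ) → ℝ)) :
    K.Support → ℝ :=
  open Classical in
  -- The first sum penalizes leaving Θ_τ in |Δ|; the terms of the second are max(0, -L).
  ∑ ρ with ¬ρ ≤ τ, K.bump ρ + ∑ L ∈ D, -((fun _ => ((0 : ℚ) : ℝ)) ⊓ L ∘ K.coords)

theorem defect_mem [Fintype P] {S : Set (K.Support → ℝ)} (hS : IsTropicallyClosed S)
    (hb : ∀ ρ, K.bump ρ ∈ S) (τ : P) {D : Finset ((Vf ⊕ Vinf → ℝ) → ℝ)}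
    (hD : ∀ L ∈ D, IsIntQAffine L) : defect τ D ∈ S :=
  hS.add_mem _ (hS.sum_mem _ fun ρ _ => hb ρ) _ (hS.sum_mem _ fun L hL =>
    hS.neg_mem _ (hS.inf_mem _ (hS.const_mem 0) _ (hS.comp_coords_mem hb (hD L hL))))

theorem defect_bounds [Fintype P] {τ : P} {D : Finset ((Vf ⊕ Vinf → ℝ) → ℝ)} {p : K.Support} :
    0 ≤ defect τ D p ∧ (∀ ρ, ¬ρ ≤ τ → K.bump ρ p ≤ defect τ D p) ∧
      ∀ L ∈ D, -L (K.coords p) ≤ defect τ D p := by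
  classical
  have hval : defect τ D p = ∑ ρ with ¬ρ ≤ τ, K.bump ρ p + ∑ L ∈ D, -(0 ⊓ L (K.coords p)) := by
    simp [defect, Finset.sum_apply]
  have hterm : ∀ L ∈ D, 0 ≤ -(0 ⊓ L (K.coords p)) := fun L _ => by simp
  have h1 : 0 ≤ ∑ ρ with ¬ρ ≤ τ, K.bump ρ p := Finset.sum_nonneg fun ρ _ => K.bump_nonneg ρ p
  have h2 := Finset.sum_nonneg hterm
  rw [hval]
  refine ⟨add_nonneg h1 h2, fun ρ hρ => ?_, fun L hL => ?_⟩
  · exact le_add_of_le_of_nonneg (Finset.single_le_sum (f := fun ρ => K.bump ρ p)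
      (fun ρ _ => K.bump_nonneg ρ p) (by simpa using hρ)) h2
  · refine le_add_of_nonneg_of_le h1 (le_trans ?_ (Finset.single_le_sum hterm hL))
    exact neg_le_neg inf_le_right

theorem defect_eq_zero [Fintype P] {τ : P} (hτ : τ ∈ K.cells) {D : Finset ((Vf ⊕ Vinf → ℝ) → ℝ)}
    {u : Vf ⊕ Vinf → ℝ} (hu : u ∈ K.Theta τ) (hD : ∀ L ∈ D, 0 ≤ L u) :
    defect τ D (K.point τ hτ u hu) = 0 := by
  classical
  have h1 : ∀ ρ ∈ Finset.univ.filter fun ρ => ¬ρ ≤ τ, K.bump ρ (K.point τ hτ u hu) = 0 :=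
    fun ρ hρ => K.bump_point_of_not_le (by simpa using hρ) hτ hu
  have h2 : ∀ L ∈ D, -(0 ⊓ L u) = 0 := fun L hL => by simp [hD L hL]
  simp only [defect, Pi.add_apply, Finset.sum_apply, Pi.neg_apply, Pi.inf_apply,
    Function.comp_apply, coords_point, Rat.cast_zero]
  rw [Finset.sum_eq_zero h1, Finset.sum_eq_zero h2, add_zero]

/-- If σ is the carrier of `u`, then `bump σ` is positive at the point, so σ ≤ τ. Hence the glued
points coincide, not merely their coordinates. -/
theorem exists_point_eq_of_defect_eq_zero [Fintype P] {τ η : P} (hτ : τ ∈ K.cells)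
    (hη : η ∈ K.cells) {D : Finset ((Vf ⊕ Vinf → ℝ) → ℝ)} {u : Vf ⊕ Vinf → ℝ}
    (hu : u ∈ K.Theta η) (h : defect τ D (K.point η hη u hu) = 0) :
    (∀ L ∈ D, 0 ≤ L u) ∧ ∃ hu' : u ∈ K.Theta τ, K.point η hη u hu = K.point τ hτ u hu' := by
  obtain ⟨-, hb, hD⟩ := defect_bounds (K := K) (τ := τ) (D := D) (p := K.point η hη u hu)
  rw [h] at hb hD
  refine ⟨fun L hL => by simpa using hD L hL, ?_⟩
  obtain ⟨σ, hση, hσ, huσ, hsupp⟩ := K.exists_cell_zeta_eq_support hu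
  have hστ : σ ≤ τ := by
    by_contra hc
    have h0 := hb σ hc
    rw [K.bump_point_of_le hση] at h0
    have : Nonempty (K.ζ σ) := by
      obtain ⟨v, hv⟩ := hσ
      exact ⟨⟨_, hv⟩⟩
    obtain ⟨y, hy⟩ := exists_eq_ciInf_of_finite (f := fun x : K.ζ σ => u x)
    have hy0 : u y ≠ 0 := (Set.ext_iff.1 hsupp _).1 y.2
    exact hy0 (le_antisymm (hy.trans_le h0) (hu.1 y))
  have hu' : u ∈ K.Theta τ := extSimplex_mono (K.zeta_mono hστ) huσ
  exact ⟨hu', (K.point_eq hση hσ hη huσ hu).symm.trans (K.point_eq hστ hσ hτ huσ hu')⟩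

/-- A half-line along which the defect of a cell in `Θ_τ` is bounded points in a recession direction
of this cell. -/
theorem exists_le_infPart_of_defect_le [Fintype P] {τ : P} {D : Finset ((Vf ⊕ Vinf → ℝ) → ℝ)}
    (l : K.HalfLine) {β : ℝ} (h : ∀ t ht, defect τ D (l.pt t ht) ≤ β) :
    (∃ σ, σ ≤ K.infPart l.cell ∧ σ ≤ K.infPart τ ∧ K.ζ σ = {x | l.dir x ≠ 0}) ∧
      ∀ L ∈ D, ∀ (φ : (Vf ⊕ Vinf → ℝ) →ₗ[ℝ] ℝ) (c : ℝ), (∀ u, L u = φ u + c) → 0 ≤ φ l.dir := by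
  have hle := fun t ht => defect_bounds (K := K) (τ := τ) (D := D) (p := l.pt t ht)
  refine ⟨?_, fun L hL φ c hφ => ?_⟩
  · obtain ⟨σ, hσ, hsupp⟩ := K.exists_zeta_eq_support l.dir_mem.2
    refine ⟨σ, hσ, K.infPart_mono hσ ?_, hsupp⟩
    by_contra hc
    have hne : Nonempty (K.ζ σ) := by
      obtain ⟨x, hx⟩ := Function.ne_iff.1 l.dir_ne_zero
      exact ⟨⟨x, hsupp ▸ hx⟩⟩
    obtain ⟨y, hy⟩ := exists_eq_ciInf_of_finite (f := fun x : K.ζ σ => l.dir x)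
    have hy0 : l.dir y ≠ 0 := (Set.ext_iff.1 hsupp _).1 y.2
    have hpos : 0 < l.dir y := lt_of_le_of_ne (l.dir_mem.1 y) hy0.symm
    -- If the carrier σ of the direction were not below τ, the defect would dominate `bump σ`, which
    -- grows at least at the positive rate `l.dir y`.
    refine absurd (nonneg_of_forall_nonneg_add_mul (a := β) (b := -l.dir y) fun t ht => ?_)
      (by linarith)
    have h1 := ((hle t ht).2.1 σ hc).trans (h t ht)
    rw [HalfLine.pt, K.bump_point_of_le (hσ.trans (K.infPart_le _))] at h1
    have h2 : t * l.dir y ≤ ⨅ x : K.ζ σ, (l.origin + t • l.dir) x := le_ciInf fun z => by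
      have h3 : l.dir y ≤ l.dir z :=
        hy.trans_le (ciInf_le (Set.finite_range fun x : K.ζ σ => l.dir x).bddBelow z)
      have h4 := l.origin_mem.1 z
      have h5 := mul_le_mul_of_nonneg_left h3 ht
      simp only [Pi.add_apply, Pi.smul_apply, smul_eq_mul]
      linarith
    linarith
  · refine nonneg_of_forall_nonneg_add_mul (a := β + (φ l.origin + c)) fun t ht => ?_
    have h1 := ((hle t ht).2.2 L hL).trans (h t ht)
    rw [HalfLine.pt, coords_point, hφ, map_add, map_smul, smul_eq_mul] at h1
    linarith

/-- The main estimate. It is proved cell by cell on an arrangement adapted to both `F` and the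
defect, by applying `exists_nat_mul_ge` to F - L and the defect; the largest of the finitely many
constants serves for all of |Δ|. -/
theorem exists_le_add_mul_defect [Fintype P] {F : K.Support → ℝ} (hF : IsRational F) {τ : P}
    (hτ : τ ∈ K.cells) {D : Finset ((Vf ⊕ Vinf → ℝ) → ℝ)} (hD : ∀ L ∈ D, IsIntQAffine L)
    {x : Vf ⊕ Vinf → ℝ} (hx : x ∈ K.Theta τ) (hxD : ∀ L ∈ D, 0 ≤ L x)
    {L : (Vf ⊕ Vinf → ℝ) → ℝ} (hL : IsIntQAffine L)
    (hFL : ∀ u (hu : u ∈ K.Theta τ), (∀ M ∈ D, 0 ≤ M u) → F (K.point τ hτ u hu) = L u) :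
    ∃ N : ℕ, ∀ p, F p ≤ L (K.coords p) + N * defect τ D p := by
  have hclosed := isTropicallyClosed_isCellwiseAffine (K := K)
  have hb : ∀ ρ, K.bump ρ ∈ {F : K.Support → ℝ | K.IsCellwiseAffine F} := isCellwiseAffine_bump
  obtain ⟨A₁, B₁, hA₁, -, hA₁', hB₁', h₁⟩ := isCellwiseAffine_of_isPiecewiseIntQAffine hF.1
  obtain ⟨A₂, B₂, hA₂, -, hA₂', hB₂', h₂⟩ := defect_mem hclosed hb τ hD
  obtain ⟨T, hT₀, hT', hT⟩ := exists_signCell_subset_extSimplex (Vf := Vf) (Vinf := Vinf)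
  obtain ⟨C, hC, hC', hAC₁, hAC₂, hTC⟩ : ∃ C : Set ((Vf ⊕ Vinf → ℝ) → ℝ), C.Finite ∧
      (∀ L ∈ C, IsIntQAffine L) ∧ A₁ ⊆ C ∧ A₂ ⊆ C ∧ T ⊆ C := by
    refine ⟨A₁ ∪ A₂ ∪ T, (hA₁.union hA₂).union hT₀, ?_,
      Set.subset_union_left.trans Set.subset_union_left,
      Set.subset_union_right.trans Set.subset_union_left, Set.subset_union_right⟩
    rintro M ((hM | hM) | hM)
    exacts [hA₁' M hM, hA₂' M hM, hT' M hM]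
  obtain ⟨φ, c, hφ⟩ := hL.exists_linearMap
  have hcell : ∀ i : Σ η : K.cells, (signCell C '' K.Theta η.1), ∃ N : ℕ,
      ∀ u (hu : u ∈ K.Theta i.1.1), u ∈ i.2.1 →
        F (K.point i.1.1 i.1.2 u hu) ≤ L u + N * defect τ D (K.point i.1.1 i.1.2 u hu) := by
    rintro ⟨⟨η, hη⟩, ⟨_, z, hz, rfl⟩⟩
    obtain ⟨M₁, hM₁, hFM⟩ := h₁ η hη z hz
    obtain ⟨M₂, hM₂, hdM⟩ := h₂ η hη z hz
    obtain ⟨φ₁, c₁, hφ₁⟩ := (hB₁' M₁ hM₁).exists_linearMap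
    obtain ⟨φ₂, c₂, hφ₂⟩ := (hB₂' M₂ hM₂).exists_linearMap
    replace hFM : ∀ u (hu : u ∈ K.Theta η), u ∈ signCell C z →
        F (K.point η hη u hu) = φ₁ u + c₁ := fun u hu huz =>
      (hFM u hu (signCell_anti hAC₁ z huz)).trans (hφ₁ u)
    replace hdM : ∀ u (hu : u ∈ K.Theta η), u ∈ signCell C z →
        defect τ D (K.point η hη u hu) = φ₂ u + c₂ := fun u hu huz =>
      (hdM u hu (signCell_anti hAC₂ z huz)).trans (hφ₂ u)
    have hΘ : signCell C z ⊆ K.Theta η := hT C hTC _ z hz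
    have := (signConstraints_finite hC z).to_subtype
    choose! ψ γ hψ using fun (M : (Vf ⊕ Vinf → ℝ) → ℝ) (hM : M ∈ signConstraints C z) =>
      (isIntQAffine_of_mem_signConstraints hC' hM).exists_linearMap
    have hmem : ∀ u, (∀ M : signConstraints C z, 0 ≤ ψ M u + γ M) ↔ u ∈ signCell C z := fun u => by
      rw [signCell_eq, Set.mem_ofPred_eq, Subtype.forall]
      exact forall₂_congr fun M hM => by rw [hψ M hM]
    obtain ⟨N, hN⟩ := exists_nat_mul_ge (fun M : signConstraints C z => ψ M) (fun M => γ M)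
      (φ₁ - φ) φ₂ (c₁ - c) c₂ (fun u hu => by
        rw [hmem] at hu
        rw [← hdM u (hΘ hu) hu]
        exact defect_bounds.1) (fun u hu hzero => by
        rw [hmem] at hu
        rw [← hdM u (hΘ hu) hu] at hzero
        obtain ⟨hDu, huτ, hpt⟩ := exists_point_eq_of_defect_eq_zero hτ hη (hΘ hu) hzero
        have h3 := hFM u (hΘ hu) hu
        rw [hpt, hFL u huτ hDu, hφ] at h3
        rw [LinearMap.sub_apply]
        linarith) (fun w hw hw₂ => by
        rcases eq_or_ne w 0 with rfl | hw0
        · simp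
        have hray : ∀ t : ℝ, 0 ≤ t → z + t • w ∈ signCell C z := fun t ht => by
          rw [← hmem]
          intro M
          have h3 := (hmem z).2 (self_mem_signCell C z) M
          have h4 := mul_nonneg ht (hw M)
          rw [map_add, map_smul, smul_eq_mul]
          linarith
        let l : K.HalfLine := ⟨η, hη, z, hz, w,
          mem_orthant_of_forall_mem_Theta fun t ht => hΘ (hray t ht), hw0⟩
        -- As `φ₂ w ≤ 0`, the defect along `l` never exceeds its value at `z`.
        obtain ⟨⟨σ, hση, hστ, hsupp⟩, hDw⟩ := exists_le_infPart_of_defect_le (τ := τ) (D := D) l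
          (β := φ₂ z + c₂) fun t ht => by
            refine (hdM _ (l.mem_Theta ht) (hray t ht)).trans_le ?_
            have h3 := mul_nonpos_of_nonneg_of_nonpos ht hw₂
            change φ₂ (z + t • w) + c₂ ≤ _
            rw [map_add, map_smul, smul_eq_mul]
            linarith
        have hwτ : w ∈ orthant (K.ζ (K.infPart τ)) := by
          refine ⟨l.dir_mem.1, fun y hy => ?_⟩
          by_contra hy0
          exact hy (K.zeta_mono hστ (hsupp ▸ hy0))
        -- The parallel half-line from `x` stays in the cell where F = L. Equality of slopes for F
        -- therefore gives `φ₁ w = φ w`.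
        let l' : K.HalfLine := ⟨τ, hτ, x, hx, w, hwτ, hw0⟩
        obtain ⟨s, hs, hs'⟩ := hF.2 l l' (HalfLine.parallel_of_le hση hστ hsupp rfl)
        have h3 : l.HasSlopeAtInfinity F (φ₁ w) := hasSlopeAtInfinity_of_eqOn l (c := c₁)
          fun t ht => hFM _ (l.mem_Theta ht) (hray t ht)
        have h4 : l'.HasSlopeAtInfinity F (φ w) := hasSlopeAtInfinity_of_eqOn l' (c := c)
          fun t ht => (hFL _ (l'.mem_Theta ht) fun M hM => by
            obtain ⟨ψ', c', hψ'⟩ := (hD M hM).exists_linearMap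
            have h5 := hxD M hM
            have h6 : 0 ≤ ψ' w := hDw M hM ψ' c' hψ'
            have h7 := mul_nonneg ht h6
            change 0 ≤ M (x + t • w)
            rw [hψ'] at h5 ⊢
            rw [map_add, map_smul, smul_eq_mul]
            linarith).trans (hφ _)
        rw [LinearMap.sub_apply, h3.unique hs, h4.unique hs', sub_self])
    refine ⟨N, fun u hu huz => ?_⟩
    have h3 := hN u ((hmem u).2 huz)
    rw [← hdM u hu huz, LinearMap.sub_apply] at h3
    rw [hFM u hu huz, hφ]
    linarith
  choose N hN using hcell
  have := fun η : K.cells =>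
    ((finite_range_signCell hC).subset (Set.image_subset_range _ (K.Theta η.1))).to_subtype
  obtain ⟨N₀, hN₀⟩ := Finite.exists_le N
  refine ⟨N₀, fun p => ?_⟩
  obtain ⟨η, hη, u, hu, rfl⟩ := K.exists_point_eq p
  refine (hN ⟨⟨η, hη⟩, ⟨_, u, hu, rfl⟩⟩ u hu (self_mem_signCell C u)).trans ?_
  rw [coords_point]
  gcongr
  · exact defect_bounds.1
  · exact hN₀ _

theorem mem_of_isRational [Nonempty Vf] [Finite P] {S : Set (K.Support → ℝ)}
    (hS : IsTropicallyClosed S) (hb : ∀ ρ, K.bump ρ ∈ S) {F : K.Support → ℝ}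
    (hF : IsRational F) : F ∈ S := by
  have := Fintype.ofFinite P
  obtain ⟨A, B, hA, -, hA', hB', h⟩ := isCellwiseAffine_of_isPiecewiseIntQAffine hF.1
  have hfin := fun τ : K.cells =>
    ((finite_range_signCell hA).subset (Set.image_subset_range _ (K.Theta τ.1))).to_subtype
  have hH : ∀ i : Σ τ : K.cells, (signCell A '' K.Theta τ.1), ∃ H ∈ S, F ≤ H ∧
      ∀ u (hu : u ∈ K.Theta i.1.1), u ∈ i.2.1 →
        H (K.point i.1.1 i.1.2 u hu) = F (K.point i.1.1 i.1.2 u hu) := by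
    rintro ⟨⟨τ, hτ⟩, ⟨_, x, hx, rfl⟩⟩
    obtain ⟨L, hL, hFL⟩ := h τ hτ x hx
    set D := (signConstraints_finite hA x).toFinset with hDdef
    have hD : ∀ M ∈ D, IsIntQAffine M := fun M hM =>
      isIntQAffine_of_mem_signConstraints hA' ((Set.Finite.mem_toFinset _).1 hM)
    have hcell : ∀ u, (∀ M ∈ D, 0 ≤ M u) ↔ u ∈ signCell A x := fun u => by
      simp [signCell_eq, hDdef]
    obtain ⟨N, hN⟩ := exists_le_add_mul_defect hF hτ hD hx ((hcell x).2 (self_mem_signCell A x))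
      (hB' L hL) fun u hu huD => hFL u hu ((hcell u).1 huD)
    refine ⟨L ∘ K.coords + N • defect τ D, hS.add_mem _ (hS.comp_coords_mem hb (hB' L hL)) _
      (hS.nsmul_mem (defect_mem hS hb τ hD) N), fun p => by simpa using hN p, fun u hu hux => ?_⟩
    simp [defect_eq_zero hτ hu ((hcell u).2 hux), hFL u hu hux]
  choose H hHS hFH hHF using hH
  have := Fintype.ofFinite (Σ τ : K.cells, (signCell A '' K.Theta τ.1))
  have hpt : ∀ p, ∃ i, H i p = F p := fun p => by
    obtain ⟨τ, hτ, u, hu, rfl⟩ := K.exists_point_eq p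
    exact ⟨_, hHF ⟨⟨τ, hτ⟩, ⟨_, u, hu, rfl⟩⟩ u hu (self_mem_signCell A u)⟩
  obtain ⟨p₀⟩ := (inferInstance : Nonempty K.Support)
  have hne : (Finset.univ : Finset (Σ τ : K.cells, (signCell A '' K.Theta τ.1))).Nonempty :=
    ⟨(hpt p₀).choose, Finset.mem_univ _⟩
  -- Every `H i` lies above F, and at each point the one belonging to a cell through it equals F.
  have hF_eq : F = Finset.univ.inf' hne H := by
    refine le_antisymm (Finset.le_inf' _ _ fun i _ => hFH i) fun p => ?_
    obtain ⟨i, hi⟩ := hpt p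
    exact (Finset.inf'_le H (Finset.mem_univ i) p).trans_eq hi
  rw [hF_eq]
  exact Finset.inf'_mem S hS.inf_mem _ hne H fun i _ => hHS i

end AbstractComplex

/-! ### Tropical fractions of polynomial expressions. -/

section Fractions

variable {X : Type*} {r : ℕ}

/-- The real-valued functions which are differences of polynomial expressions in the `s i`. -/
def realFractions (s : Fin r → X → Tropical (WithTop ℝ)) : Set (X → ℝ) :=
  {F | ∃ (p q : MvPolynomial (Fin r) TQ) (f g : X → ℝ), p.eval₂ (constHom X) s = tropReal f ∧
    q.eval₂ (constHom X) s = tropReal g ∧ F = f - g}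

variable {s : Fin r → X → Tropical (WithTop ℝ)}

theorem isTropicallyClosed_realFractions : IsTropicallyClosed (realFractions s) where
  const_mem c := ⟨MvPolynomial.C (Tropical.trop c), 1, fun _ => c, 0,
    by rw [MvPolynomial.eval₂_C, constHom_coe], MvPolynomial.eval₂_one _ _, (sub_zero _).symm⟩
  neg_mem := by
    rintro _ ⟨p, q, f, g, hp, hq, rfl⟩
    exact ⟨q, p, g, f, hq, hp, neg_sub f g⟩
  add_mem := by
    rintro _ ⟨p, q, f, g, hp, hq, rfl⟩ _ ⟨p', q', f', g', hp', hq', rfl⟩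
    refine ⟨p * p', q * q', f + f', g + g', ?_, ?_, (add_sub_add_comm f f' g g').symm⟩
    · rw [MvPolynomial.eval₂_mul, hp, hp', tropReal_add]
    · rw [MvPolynomial.eval₂_mul, hq, hq', tropReal_add]
  inf_mem := by
    rintro _ ⟨p, q, f, g, hp, hq, rfl⟩ _ ⟨p', q', f', g', hp', hq', rfl⟩
    -- Common denominators: min(f - g, f' - g') = min(f + g', f' + g) - (g + g').
    refine ⟨p * q' + p' * q, q * q', (f + g') ⊓ (f' + g), g + g', ?_, ?_, ?_⟩
    · rw [MvPolynomial.eval₂_add, MvPolynomial.eval₂_mul, MvPolynomial.eval₂_mul, hp, hp', hq, hq',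
        tropReal_inf, tropReal_add, tropReal_add]
    · rw [MvPolynomial.eval₂_mul, hq, hq', tropReal_add]
    · rw [inf_sub]
      congr 1 <;> abel

theorem mem_realFractions {i : Fin r} {F : X → ℝ} (h : s i = tropReal F) :
    F ∈ realFractions s :=
  ⟨MvPolynomial.X i, 1, F, 0, by rw [MvPolynomial.eval₂_X, h], MvPolynomial.eval₂_one _ _,
    (sub_zero F).symm⟩

theorem tropReal_mem_fractions [Nonempty X] {F : X → ℝ} (h : F ∈ realFractions s) :
    tropReal F ∈ fractions s := by
  obtain ⟨p, q, f, g, hp, hq, rfl⟩ := h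
  refine ⟨p, q, hq ▸ tropReal_ne_zero g, ?_⟩
  rw [hp, hq, ← tropReal_add, sub_add_cancel]

theorem zero_mem_fractions [Nonempty X] : 0 ∈ fractions s :=
  ⟨0, 1, by rw [MvPolynomial.eval₂_one, ← tropReal_zero]; exact tropReal_ne_zero 0,
    by rw [MvPolynomial.eval₂_zero, zero_mul]⟩

theorem IsSemifieldOverTQ.fractions_subset {S : Set (X → Tropical (WithTop ℝ))}
    (hS : IsSemifieldOverTQ S) (hs : ∀ i, s i ∈ S) : fractions s ⊆ S := by
  have heval : ∀ p : MvPolynomial (Fin r) TQ, p.eval₂ (constHom X) s ∈ S := fun p => by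
    induction p using MvPolynomial.induction_on with
    | C a =>
      rw [MvPolynomial.eval₂_C]
      exact hS.const_mem a
    | add p q hp hq =>
      rw [MvPolynomial.eval₂_add]
      exact hS.add_mem _ hp _ hq
    | mul_X p i hp =>
      rw [MvPolynomial.eval₂_mul, MvPolynomial.eval₂_X]
      exact hS.mul_mem _ hp _ (hs i)
  rintro F ⟨p, q, hq, h⟩
  obtain ⟨G, hG, hqG⟩ := hS.exists_inv _ (heval q) hq
  have : F = p.eval₂ (constHom X) s * G := by rw [← h, mul_assoc, hqG, mul_one]
  rw [this]
  exact hS.mul_mem _ (heval p) _ hG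

end Fractions

end TropicalFF

theorem theorem1p2 {Vf Vinf P : Type*} [Fintype Vf] [Nonempty Vf] [Fintype Vinf]
    [PartialOrder P] [OrderBot P] [Finite P]
    (K : TropicalFF.AbstractComplex Vf Vinf P) :
    TropicalFF.IsSemifieldOverTQ K.Rat ∧ TropicalFF.IsFinitelyGeneratedOverTQ K.Rat := by
  open TropicalFF TropicalFF.AbstractComplex in
  have hsf : IsSemifieldOverTQ K.Rat := isSemifieldOverTQ_Rat
  refine ⟨hsf, ?_⟩
  obtain ⟨r, ⟨e⟩⟩ := Finite.exists_equiv_fin P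
  have hs : ∀ i, tropReal (K.bump (e.symm i)) ∈ K.Rat := fun i =>
    mem_Rat_iff.2 (Or.inr ⟨_, isRational_bump _, rfl⟩)
  refine ⟨r, fun i => tropReal (K.bump (e.symm i)), hs, Set.Subset.antisymm (fun G hG => ?_)
    (hsf.fractions_subset hs)⟩
  rcases mem_Rat_iff.1 hG with rfl | ⟨F, hF, rfl⟩
  · exact zero_mem_fractions
  · refine tropReal_mem_fractions (mem_of_isRational isTropicallyClosed_realFractions
      (fun ρ => mem_realFractions (i := e ρ) ?_) hF)
    rw [Equiv.symm_apply_apply]
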